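/- Let $X_1,X_2,\dots$ be i.i.d. real random variables with distribution function $F$ and $\mathsf E[|X_1|]<\infty$. Put $Z_n=\max(X_1,\dots,X_n)$, $x^*=\sup\{v\in\mathbb R: F(v)<1\}\in(-\infty,\infty]$, assume $x^*\neq 0$, and let $U(t)=\inf\{y\in\mathbb R: 1/(1-F(y))\ge t\}$ (with $1/0=\infty$). For $x\ne0$, $x<x^*$ let $R_n(x)=(Z_n-x)_+/|x|$, and, if $x^*<\infty$, for $x<x^*$ let $\Delta_n(x)=(x^*-\max(Z_n,x))/|x^*|$. For $\alpha\in\mathbb R$ let $\mathcal R_\alpha$ be the set of eventually positive functions $f$ with $f(tx)/f(t)\to x^\alpha$ as $t\to\infty$ for all $x>0$ (slowly varying means $\alpha=0$). Assume that there are constants $a_n>0$, $b_n\in\mathbb R$ and a non-degenerate distribution function $G$ with $\lim_{n\to\infty}F(a_nz+b_n)^n=G(z)$ at every continuity point $z$ of $G$. Then there exist $\xi\in\mathbb R$ and a positive function $a$ such that $$\lim_{t\to\infty}\frac{U(tx)-U(t)}{a(t)}=\frac{x^\xi-1}{\xi}\quad\text{for all }x>0,\qquad(*)$$ where the right-hand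 side is read as $\log x$ if $\xi=0$. Moreover, for every $\xi<1$ and every positive function $a$ satisfying $(*)$ the following hold, where $\Gamma$ is the gamma function (extended to non-integer negative arguments). 1. If $0<\xi<1$, then $x^*=\infty$, $a\in\mathcal R_\xi$, and for all $x\ne0$ $$\lim_{n\to\infty}\frac{\mathsf E[R_n(x)]}{a(n)}=-\frac{\Gamma(-\xi)}{|x|}>0.$$ 2. If $\xi=0$ and $x^*=\infty$, then $U\in\mathcal R_0$, and for all $x\neq0$ $$\lim_{n\to\infty}\frac{\mathsf E[R_n(x)]}{U(n)}=\frac1{|x|}.$$ 3. If $\xi=0$ and $x^*<\infty$, then the function $t\mapsto x^*-U(t)$ is in $\mathcal R_0$, and $$\lim_{n\to\infty}\frac{1}{x^*-U(n)}\left(\frac{x^*-x}{|x|}-\mathsf E[R_n(x)]\right)=\frac1{|x|}\quad(x\ne0,\ x<x^*),$$ $$\lim_{n\to\infty}\frac{\mathsf E[\Delta_n(x)]}{x^*-U(n)}=\frac1{|x^*|}\quad(x<x^*).$$ 4. If $\xi<0$, then $x^*<\infty$, $a\in\mathcal R_\xi$, and $$\lim_{n\to\infty}\frac{1}{a(n)}\left(\frac{x^*-x}{|x|}-\mathsf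 E[R_n(x)]\right)=\frac{\Gamma(-\xi)}{|x|}>0\quad(x\ne0,\ x<x^*),$$ $$\lim_{n\to\infty}\frac{\mathsf E[\Delta_n(x)]}{a(n)}=\frac{\Gamma(-\xi)}{|x^*|}>0\quad(x<x^*).$$ -/

import Mathlib

open MeasureTheory ProbabilityTheory Filter Topology

namespace RMS

noncomputable section

/-- The best objective value among the first `n` iterations (`X i` is the value at iteration
`i + 1`), i.e. the maximum of `X 0, …, X (n - 1)`; only `n ≥ 1` is meaningful. -/
def best {Ω : Type*} (X : ℕ → Ω → ℝ) (n : ℕ) (ω : Ω) : ℝ :=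
  ⨆ i : Fin n, X i ω

/-- The improvement rate `R_n(x) = (Z_n - x)_+ / |x|`. -/
def improvementRate {Ω : Type*} (X : ℕ → Ω → ℝ) (n : ℕ) (x : ℝ) (ω : Ω) : ℝ :=
  max (best X n ω - x) 0 / |x|

/-- The relative gap `Δ_n(x) = (x* - max(Z_n, x)) / |x*|`, for a finite `x* = s`. -/
def relativeGap {Ω : Type*} (X : ℕ → Ω → ℝ) (s : ℝ) (n : ℕ) (x : ℝ) (ω : Ω) : ℝ :=
  (s - max (best X n ω) x) / |s|

/-- The right endpoint `x* = sup {v | F v < 1}` of a distribution function, possibly `⊤`. -/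
def rightEndpoint (F : ℝ → ℝ) : EReal :=
  sSup ((fun v : ℝ => (v : EReal)) '' {v : ℝ | F v < 1})

/-- The tail quantile function `U(t) = inf {y | 1 / (1 - F y) ≥ t}`. The condition is cleared of
its denominator, so that `1 / (1 - F y)` counts as infinite where `F y = 1`. -/
def tailQuantile (F : ℝ → ℝ) (t : ℝ) : ℝ :=
  sInf {y : ℝ | t * (1 - F y) ≤ 1}

/-- The fundamental assumption of extreme value theory: `F` lies in the maximum domain of
attraction of some non-degenerate distribution (the law `ν`, with distribution function
`cdf ν`). -/
def InSomeMDA (F : ℝ → ℝ) : Prop :=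
  ∃ (a b : ℕ → ℝ) (ν : Measure ℝ),
    (∀ n, 0 < a n) ∧ IsProbabilityMeasure ν ∧ (∀ c : ℝ, ν ≠ Measure.dirac c) ∧
    ∀ z : ℝ, ContinuousAt (cdf ν) z →
      Tendsto (fun n : ℕ => F (a n * z + b n) ^ n) atTop (𝓝 (cdf ν z))

/-- `(x ^ ξ - 1) / ξ`, read as `log x` when `ξ = 0`. -/
def boxCox (ξ x : ℝ) : ℝ :=
  if ξ = 0 then Real.log x else (x ^ ξ - 1) / ξ

/-- `a` is a positive function with `(U(tx) - U(t)) / a(t) → (x ^ ξ - 1) / ξ` as `t → ∞`,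
for every `x > 0`. -/
def IsAuxiliary (F : ℝ → ℝ) (ξ : ℝ) (a : ℝ → ℝ) : Prop :=
  (∀ t : ℝ, 1 ≤ t → 0 < a t) ∧
  ∀ x : ℝ, 0 < x →
    Tendsto (fun t : ℝ => (tailQuantile F (t * x) - tailQuantile F t) / a t) atTop
      (𝓝 (boxCox ξ x))

/-- The class of regularly varying functions with index `α`. -/
def RegularlyVarying (α : ℝ) (f : ℝ → ℝ) : Prop :=
  (∀ᶠ t in atTop, 0 < f t) ∧
  ∀ x : ℝ, 0 < x → Tendsto (fun t : ℝ => f (t * x) / f t) atTop (𝓝 (x ^ α))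

end

end RMS

namespace RMS

/-! ### The tail quantile function -/

section TailQuantile

variable {μ : Measure ℝ}

/-! Everything is expressed through the tail quantile function U, in two largely independent halves.

Probabilistic half. If V is the maximum of n independent uniform variables, then Z_n has the law of
U(n/S) with S = n(1 - V), whose density on (0, n) is (1 - s/n)^(n-1) (`map_best_eq`). Hence
E[h(Z_n)] is the integral of (1 - s/n)^(n-1) h(U(n/s)). When k = h ∘ U is regularly varying of index
ρ < 1, division by k(n) makes the integrand converge to e^(-s) s^(-ρ), and Potter-type bounds
justify dominated convergence, so the limit is Γ(1 - ρ) (`tendsto_integral_of_regularlyVarying`).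
Here h is the excess (z - x)_+ or the gap x* - max(z, x), according to whether x* is infinite or
finite.

Analytic half. Condition (*) makes a regularly varying of index ξ. It also compares U with a: U/a →
1/ξ if ξ > 0, and (x* - U)/a → -1/ξ if ξ < 0. If ξ = 0 the corresponding quotient tends to ∞, so
that U or x* - U is slowly varying. With Γ(1 - ξ) = -ξ Γ(-ξ) this gives the stated constants.

Existence of ξ and a is the extremal types theorem (`exists_isAuxiliary`). Convergence of F^n
becomes convergence of normalised quantiles; in logarithmic time the limit solves a functional
equation whose monotone solutions are multiples of (e^(ξs) - 1)/ξ. -/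

lemma tailQuantile_le_iff {t : ℝ} (ht : 1 < t) (y : ℝ) :
    tailQuantile (cdf μ) t ≤ y ↔ t * (1 - cdf μ y) ≤ 1 := by
  have ht0 : 0 < t := by linarith
  set S : Set ℝ := {y : ℝ | t * (1 - cdf μ y) ≤ 1} with hS
  have hup : ∀ {x y : ℝ}, x ∈ S → x ≤ y → y ∈ S := by
    intro x y hx hxy
    have := monotone_cdf μ hxy
    simp only [hS, Set.mem_ofPred_eq] at hx ⊢
    nlinarith
  have hne : S.Nonempty := by
    have h1 : Tendsto (fun y => t * (1 - cdf μ y)) atTop (𝓝 (t * (1 - 1))) :=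
      ((tendsto_cdf_atTop μ).const_sub 1).const_mul t
    rw [sub_self, mul_zero] at h1
    obtain ⟨y, hy⟩ := (h1.eventually_lt_const zero_lt_one).exists
    exact ⟨y, hy.le⟩
  -- This is where t > 1 matters: for t ≤ 1 the set is all of ℝ.
  have hbdd : BddBelow S := by
    have h1 : Tendsto (fun y => t * (1 - cdf μ y)) atBot (𝓝 (t * (1 - 0))) :=
      ((tendsto_cdf_atBot μ).const_sub 1).const_mul t
    rw [sub_zero, mul_one] at h1
    obtain ⟨y, hy⟩ := (h1.eventually_const_lt ht).exists
    refine ⟨y, fun z hz => ?_⟩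
    by_contra hlt
    exact absurd (hup hz (not_le.1 hlt).le) (not_le.2 hy)
  -- Right continuity of the distribution function makes the infimum a minimum, which yields the
  -- Galois connection.
  have hmem : sInf S ∈ S := by
    have h1 : Tendsto (fun y => t * (1 - cdf μ y)) (𝓝[>] sInf S)
        (𝓝 (t * (1 - cdf μ (sInf S)))) :=
      ((((cdf μ).right_continuous (sInf S)).mono Set.Ioi_subset_Ici_self).tendsto.const_sub
        1).const_mul t
    refine le_of_tendsto h1 ?_
    filter_upwards [self_mem_nhdsWithin] with y hy
    obtain ⟨z, hz, hzy⟩ := exists_lt_of_csInf_lt hne hy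
    exact hup hz hzy.le
  exact ⟨fun h => hup hmem h, fun h => csInf_le hbdd h⟩

lemma lt_tailQuantile_iff {t : ℝ} (ht : 1 < t) (y : ℝ) :
    y < tailQuantile (cdf μ) t ↔ 1 < t * (1 - cdf μ y) := by
  rw [← not_le, tailQuantile_le_iff ht, not_le]

variable (μ) in
-- The restriction to t > 1 is needed: for t ≤ 1 the defining set is unbounded below and `sInf`
-- returns the default value 0.
lemma monotoneOn_tailQuantile : MonotoneOn (tailQuantile (cdf μ)) (Set.Ioi 1) := by
  intro s hs t ht hst
  rw [tailQuantile_le_iff hs]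
  have h1 := (tailQuantile_le_iff (μ := μ) ht _).1 le_rfl
  have h2 := cdf_le_one μ (tailQuantile (cdf μ) t)
  nlinarith

lemma rightEndpoint_eq_top_iff : rightEndpoint (cdf μ) = ⊤ ↔ ∀ v, cdf μ v < 1 := by
  constructor
  · intro h v
    have : ((v : ℝ) : EReal) < rightEndpoint (cdf μ) := by rw [h]; exact EReal.coe_lt_top v
    obtain ⟨_, ⟨w, hw, rfl⟩, hvw⟩ := lt_sSup_iff.1 this
    exact (monotone_cdf μ (EReal.coe_lt_coe_iff.1 hvw).le).trans_lt hw
  · intro h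
    rw [EReal.eq_top_iff_forall_lt]
    intro v
    refine lt_of_lt_of_le (EReal.coe_lt_coe_iff.2 (lt_add_one v)) (le_sSup ⟨v + 1, h _, rfl⟩)

lemma tendsto_tailQuantile_atTop_iff :
    Tendsto (tailQuantile (cdf μ)) atTop atTop ↔ rightEndpoint (cdf μ) = ⊤ := by
  rw [rightEndpoint_eq_top_iff]
  constructor
  · intro h v
    obtain ⟨t, ht, ht1⟩ := ((h.eventually_gt_atTop v).and (eventually_gt_atTop 1)).exists
    have := (lt_tailQuantile_iff ht1 v).1 ht
    have ht0 : 0 < t := by linarith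
    by_contra hv
    nlinarith [not_lt.1 hv]
  · intro h
    rw [tendsto_atTop]
    intro v
    have hv : 0 < 1 - cdf μ v := sub_pos.2 (h v)
    filter_upwards [eventually_gt_atTop 1, eventually_gt_atTop (1 / (1 - cdf μ v))] with t h1 h2
    refine ((lt_tailQuantile_iff h1 v).2 ?_).le
    rwa [div_lt_iff₀ hv] at h2

lemma cdf_lt_one_of_lt_rightEndpoint {s v : ℝ} (h : rightEndpoint (cdf μ) = (s : EReal))
    (hv : v < s) : cdf μ v < 1 := by
  have : ((v : ℝ) : EReal) < rightEndpoint (cdf μ) := by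
    rw [h]; exact EReal.coe_lt_coe_iff.2 hv
  obtain ⟨_, ⟨w, hw, rfl⟩, hvw⟩ := lt_sSup_iff.1 this
  exact (monotone_cdf μ (EReal.coe_lt_coe_iff.1 hvw).le).trans_lt hw

lemma cdf_rightEndpoint {s : ℝ} (h : rightEndpoint (cdf μ) = (s : EReal)) : cdf μ s = 1 := by
  have h1 : Tendsto (cdf μ) (𝓝[>] s) (𝓝 (cdf μ s)) :=
    (((cdf μ).right_continuous s).mono Set.Ioi_subset_Ici_self).tendsto
  refine le_antisymm (cdf_le_one μ s) (ge_of_tendsto h1 ?_)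
  filter_upwards [self_mem_nhdsWithin] with y hy
  by_contra hlt
  have : ((y : ℝ) : EReal) ≤ rightEndpoint (cdf μ) := le_sSup ⟨y, not_le.1 hlt, rfl⟩
  rw [h] at this
  exact absurd (EReal.coe_le_coe_iff.1 this) (not_le.2 hy)

lemma tailQuantile_le_rightEndpoint {s t : ℝ} (h : rightEndpoint (cdf μ) = (s : EReal))
    (ht : 1 < t) : tailQuantile (cdf μ) t ≤ s := by
  rw [tailQuantile_le_iff ht, cdf_rightEndpoint h]
  norm_num

lemma tendsto_tailQuantile_rightEndpoint {s : ℝ} (h : rightEndpoint (cdf μ) = (s : EReal)) :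
    Tendsto (tailQuantile (cdf μ)) atTop (𝓝 s) := by
  refine tendsto_order.2 ⟨fun v hv => ?_, fun v hv => ?_⟩
  · have hv' : 0 < 1 - cdf μ v := sub_pos.2 (cdf_lt_one_of_lt_rightEndpoint h hv)
    filter_upwards [eventually_gt_atTop 1, eventually_gt_atTop (1 / (1 - cdf μ v))] with t h1 h2
    refine (lt_tailQuantile_iff h1 v).2 ?_
    rwa [div_lt_iff₀ hv'] at h2
  · filter_upwards [eventually_gt_atTop 1] with t ht
    exact (tailQuantile_le_rightEndpoint h ht).trans_lt hv

lemma exists_rightEndpoint_eq_coe {B : ℝ} (h : ∃ᶠ t in atTop, tailQuantile (cdf μ) t ≤ B) :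
    ∃ s : ℝ, rightEndpoint (cdf μ) = (s : EReal) := by
  have htop : rightEndpoint (cdf μ) ≠ ⊤ := by
    intro htop
    have := (tendsto_tailQuantile_atTop_iff.2 htop).eventually_gt_atTop B
    obtain ⟨t, h1, h2⟩ := (h.and_eventually this).exists
    exact absurd h1 (not_le.2 h2)
  have hbot : rightEndpoint (cdf μ) ≠ ⊥ := by
    obtain ⟨v, hv⟩ := ((tendsto_cdf_atBot μ).eventually_lt_const zero_lt_one).exists
    have : ((v : ℝ) : EReal) ≤ rightEndpoint (cdf μ) := le_sSup ⟨v, hv, rfl⟩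
    intro hb
    rw [hb] at this
    exact absurd this (not_le.2 (EReal.bot_lt_coe v))
  exact ⟨_, (EReal.coe_toReal htop hbot).symm⟩

end TailQuantile

/-! ### Regular variation of auxiliary functions -/

lemma boxCox_pos {ξ x : ℝ} (hx : 1 < x) : 0 < boxCox ξ x := by
  unfold boxCox
  split_ifs with h
  · exact Real.log_pos hx
  · rcases lt_or_gt_of_ne h with h | h
    · exact div_pos_of_neg_of_neg (sub_neg.2 (Real.rpow_lt_one_of_one_lt_of_neg hx h)) h
    · exact div_pos (sub_pos.2 (Real.one_lt_rpow hx h)) h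

/-- The cocycle identity behind regular variation of a: moving the base point from t to tx rescales
increments by x^ξ. -/
lemma boxCox_mul_sub {ξ x y : ℝ} (hx : 0 < x) (hy : 0 < y) :
    boxCox ξ (x * y) - boxCox ξ x = x ^ ξ * boxCox ξ y := by
  unfold boxCox
  split_ifs with h
  · rw [h, Real.log_mul hx.ne' hy.ne', Real.rpow_zero]; ring
  · rw [Real.mul_rpow hx.le hy.le]; field_simp; ring

lemma tendsto_mul_atTop {x : ℝ} (hx : 0 < x) : Tendsto (fun t : ℝ => t * x) atTop atTop :=
  tendsto_id.atTop_mul_const hx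

lemma RegularlyVarying.congr' {α : ℝ} {f g : ℝ → ℝ} (hf : RegularlyVarying α f)
    (h : f =ᶠ[atTop] g) : RegularlyVarying α g := by
  refine ⟨?_, fun x hx => ?_⟩
  · filter_upwards [hf.1, h] with t h1 h2
    rwa [← h2]
  · refine (hf.2 x hx).congr' ?_
    filter_upwards [h, (tendsto_mul_atTop hx).eventually h] with t h1 h2
    rw [h1, h2]

lemma RegularlyVarying.of_div_tendsto {α c : ℝ} {f g : ℝ → ℝ} (hf : RegularlyVarying α f)
    (hc : 0 < c) (h : Tendsto (fun t => g t / f t) atTop (𝓝 c)) : RegularlyVarying α g := by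
  refine ⟨?_, fun x hx => ?_⟩
  · filter_upwards [hf.1, h.eventually_const_lt hc] with t h1 h2
    exact (div_pos_iff_of_pos_right h1).1 h2
  · have h1 := (((h.comp (tendsto_mul_atTop hx)).div h hc.ne').mul (hf.2 x hx))
    rw [div_self hc.ne', one_mul] at h1
    refine h1.congr' ?_
    filter_upwards [hf.1, (tendsto_mul_atTop hx).eventually hf.1, h.eventually_const_lt hc]
      with t h1 h2 h3
    have h4 : 0 < g t := (div_pos_iff_of_pos_right h1).1 h3
    simp only [Function.comp_apply, Pi.div_apply]
    field_simp

variable {F a : ℝ → ℝ} {ξ : ℝ}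

lemma IsAuxiliary.eventually_pos (h : IsAuxiliary F ξ a) : ∀ᶠ t in atTop, 0 < a t := by
  filter_upwards [eventually_ge_atTop 1] with t ht using h.1 t ht

/-- The increment U(2tx) - U(tx) can be measured against a(t) or against a(tx); the quotient of the
two limits is the limit of a(tx)/a(t). -/
lemma IsAuxiliary.regularlyVarying (h : IsAuxiliary F ξ a) : RegularlyVarying ξ a := by
  refine ⟨h.eventually_pos, fun x hx => ?_⟩
  have h2 : 0 < boxCox ξ 2 := boxCox_pos one_lt_two
  have h3 : Tendsto (fun t => (tailQuantile F (t * x * 2) - tailQuantile F (t * x)) / a (t * x))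
      atTop (𝓝 (boxCox ξ 2)) := (h.2 2 two_pos).comp (tendsto_mul_atTop hx)
  have h4 := ((h.2 (x * 2) (by positivity)).sub (h.2 x hx)).div h3 h2.ne'
  rw [boxCox_mul_sub hx two_pos, mul_div_cancel_right₀ _ h2.ne'] at h4
  refine h4.congr' ?_
  filter_upwards [h.eventually_pos, (tendsto_mul_atTop hx).eventually h.eventually_pos,
    h3.eventually_const_lt h2] with t h5 h6 h7
  have h8 : 0 < tailQuantile F (t * x * 2) - tailQuantile F (t * x) :=
    (div_pos_iff_of_pos_right h6).1 h7
  simp only [Pi.div_apply, ← mul_assoc]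
  rw [← sub_div, sub_sub_sub_cancel_right]
  field_simp

/-- If the increments `f (t * x) - f t` are of the order of `a t`, and `a t` is negligible with
respect to `f t`, then `f` is slowly varying. -/
lemma regularlyVarying_zero_of_div_tendsto_atTop {f a : ℝ → ℝ} {l : ℝ → ℝ}
    (ha : ∀ᶠ t in atTop, 0 < a t) (hfa : Tendsto (fun t => f t / a t) atTop atTop)
    (hl : ∀ x, 0 < x → Tendsto (fun t => (f (t * x) - f t) / a t) atTop (𝓝 (l x))) :
    RegularlyVarying 0 f := by
  have hpos : ∀ᶠ t in atTop, 0 < f t := by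
    filter_upwards [ha, hfa.eventually_gt_atTop 0] with t h1 h2
    exact (div_pos_iff_of_pos_right h1).1 h2
  refine ⟨hpos, fun x hx => ?_⟩
  have h1 := ((hl x hx).mul hfa.inv_tendsto_atTop).const_add 1
  rw [mul_zero, add_zero] at h1
  rw [Real.rpow_zero]
  refine h1.congr' ?_
  filter_upwards [ha, hpos] with t h2 h3
  simp only [Pi.inv_apply]
  field_simp
  ring

/-! ### Size of U, or of its gap to the endpoint, relative to a -/

/-- A bounded perturbation of a contraction along `t ↦ 2 * t` tends to zero. -/
lemma tendsto_zero_of_contraction {E g q : ℝ → ℝ} {r : ℝ} (hr : r < 1)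
    (hq : Tendsto q atTop (𝓝 r)) (hq0 : ∀ᶠ t in atTop, 0 ≤ q t) (hg : Tendsto g atTop (𝓝 0))
    (hE : ∀ᶠ t in atTop, E (t * 2) = g t + q t * E t)
    (hbdd : ∀ᶠ T in atTop, ∃ M, ∀ t ∈ Set.Icc T (T * 2), |E t| ≤ M) :
    Tendsto E atTop (𝓝 0) := by
  obtain ⟨p, hp, hp1⟩ := exists_between (max_lt hr zero_lt_one)
  obtain ⟨hrp, hp0⟩ := max_lt_iff.1 hp
  rw [Metric.tendsto_atTop]
  intro ε hε
  have hg' : ∀ᶠ t in atTop, |g t| < ε / 2 * (1 - p) := by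
    have := (tendsto_order.1 hg.abs).2 (ε / 2 * (1 - p))
    rw [abs_zero] at this
    exact this (mul_pos (by positivity) (by linarith))
  have hall := (((hg'.and (hq.eventually_lt_const hrp)).and hq0).and hE)
  obtain ⟨T0, hT0⟩ := eventually_atTop.1 hall
  obtain ⟨T, ⟨M, hM⟩, hTT0, hT1⟩ :=
    (hbdd.and ((eventually_ge_atTop T0).and (eventually_ge_atTop 1))).exists
  have hTpos : 0 < T := by linarith
  have hM0 : 0 ≤ M := (abs_nonneg _).trans (hM T ⟨le_rfl, by linarith⟩)
  -- The number ε / 2 is the fixed point of y ↦ ε / 2 * (1 - p) + p * y, so only the term p ^ k * M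
  -- evolves.
  have key : ∀ k : ℕ, ∀ u ∈ Set.Icc T (T * 2), |E (u * 2 ^ k)| ≤ ε / 2 + p ^ k * M := by
    intro k u hu
    induction k with
    | zero => simpa using (hM u hu).trans (by linarith)
    | succ k ih =>
      have hle : T0 ≤ u * 2 ^ k := by
        have : (1 : ℝ) ≤ 2 ^ k := one_le_pow₀ one_le_two
        nlinarith [hu.1]
      obtain ⟨⟨⟨h1, h2⟩, h3⟩, h4⟩ := hT0 _ hle
      rw [pow_succ, ← mul_assoc, h4]
      calc _ ≤ |g (u * 2 ^ k)| + q (u * 2 ^ k) * |E (u * 2 ^ k)| := by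
            refine (abs_add_le _ _).trans_eq ?_
            rw [abs_mul, abs_of_nonneg h3]
        _ ≤ ε / 2 * (1 - p) + p * (ε / 2 + p ^ k * M) := by gcongr
        _ = _ := by ring
  have hlim : Tendsto (fun k : ℕ => p ^ k * M) atTop (𝓝 0) := by
    simpa using (tendsto_pow_atTop_nhds_zero_of_lt_one hp0.le hp1).mul_const M
  obtain ⟨K, hK⟩ := eventually_atTop.1 (hlim.eventually_lt_const (half_pos hε))
  refine ⟨T * 2 ^ K, fun t ht => ?_⟩
  obtain ⟨k, hk1, hk2⟩ := exists_nat_pow_near (x := t / T) (y := 2)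
    (by
      rw [one_le_div hTpos]
      exact le_trans (le_mul_of_one_le_right hTpos.le (one_le_pow₀ one_le_two)) ht) one_lt_two
  have hKk : K ≤ k := by
    have : (2 : ℝ) ^ K < 2 ^ (k + 1) :=
      lt_of_le_of_lt (by rwa [le_div_iff₀ hTpos, mul_comm]) hk2
    exact Nat.lt_succ_iff.1 ((pow_lt_pow_iff_right₀ one_lt_two).1 this)
  have h2k : (0 : ℝ) < 2 ^ k := by positivity
  have hmem : t / 2 ^ k ∈ Set.Icc T (T * 2) := by
    constructor
    · rw [le_div_iff₀ h2k]
      rwa [le_div_iff₀ hTpos, mul_comm] at hk1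
    · rw [div_le_iff₀ h2k]
      rw [div_lt_iff₀ hTpos, pow_succ] at hk2
      linarith
  have := key k _ hmem
  rw [div_mul_cancel₀ _ h2k.ne'] at this
  rw [Real.dist_eq, sub_zero]
  linarith [hK k hKk]

/-- Since 2^ξ > 1, a eventually increases under doubling, so each doubling adds at least a fixed
positive amount to U; monotonicity fills in the remaining t. -/
lemma IsAuxiliary.tendsto_atTop_of_pos (h : IsAuxiliary F ξ a)
    (hmono : MonotoneOn (tailQuantile F) (Set.Ioi 1)) (hξ : 0 < ξ) :
    Tendsto (tailQuantile F) atTop atTop := by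
  set U := tailQuantile F
  have hc : 0 < boxCox ξ 2 := boxCox_pos one_lt_two
  have h1 := (h.2 2 two_pos).eventually_const_lt (half_lt_self hc)
  have h2 := (h.regularlyVarying.2 2 two_pos).eventually_const_lt (Real.one_lt_rpow one_lt_two hξ)
  obtain ⟨T0, hT0⟩ := eventually_atTop.1 (h1.and h2)
  set T := max T0 2
  have hT1 : 2 ≤ T := le_max_right _ _
  have haT : 0 < a T := h.1 T (by linarith)
  have key : ∀ k : ℕ, a T ≤ a (T * 2 ^ k) ∧
      U T + k * (boxCox ξ 2 / 2 * a T) ≤ U (T * 2 ^ k) := by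
    intro k
    induction k with
    | zero => simp
    | succ k ih =>
      have hp : (1 : ℝ) ≤ 2 ^ k := one_le_pow₀ one_le_two
      have hle : T ≤ T * 2 ^ k := le_mul_of_one_le_right (by linarith) hp
      obtain ⟨h3, h4⟩ := hT0 (T * 2 ^ k) ((le_max_left _ _).trans hle)
      have hpos : 0 < a (T * 2 ^ k) := h.1 _ (by linarith)
      rw [lt_div_iff₀ hpos] at h3 h4
      rw [pow_succ, ← mul_assoc]
      refine ⟨by linarith, ?_⟩
      push_cast
      have := mul_le_mul_of_nonneg_left ih.1 (half_pos hc).le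
      linarith
  rw [tendsto_atTop]
  intro b
  have hpos : 0 < boxCox ξ 2 / 2 * a T := mul_pos (half_pos hc) haT
  obtain ⟨k, hk⟩ := exists_nat_gt ((b - U T) / (boxCox ξ 2 / 2 * a T))
  rw [div_lt_iff₀ hpos] at hk
  filter_upwards [eventually_ge_atTop (T * 2 ^ k)] with t ht
  have hp : (1 : ℝ) ≤ 2 ^ k := one_le_pow₀ one_le_two
  have : U (T * 2 ^ k) ≤ U t :=
    hmono (by simp only [Set.mem_Ioi]; nlinarith) (by simp only [Set.mem_Ioi]; nlinarith) ht
  linarith [(key k).2]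

/-- Under doubling, U/a obeys an affine recursion whose limiting slope is 2^(-ξ) < 1 and whose
limiting fixed point is 1/ξ; the error is therefore contracted to 0. -/
lemma IsAuxiliary.tendsto_div_of_pos (h : IsAuxiliary F ξ a)
    (hmono : MonotoneOn (tailQuantile F) (Set.Ioi 1)) (hξ : 0 < ξ) :
    Tendsto (fun t => tailQuantile F t / a t) atTop (𝓝 (1 / ξ)) := by
  set U := tailQuantile F
  have hE : Tendsto (fun t => U t / a t - 1 / ξ) atTop (𝓝 0) := by
    have hq : Tendsto (fun t => a t / a (t * 2)) atTop (𝓝 (2 ^ ξ)⁻¹) := by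
      refine ((h.regularlyVarying.2 2 two_pos).inv₀ (by positivity)).congr fun t => ?_
      rw [inv_div]
    refine tendsto_zero_of_contraction (q := fun t => a t / a (t * 2))
      (g := fun t => ((U (t * 2) - U t) / a t + 1 / ξ) * (a t / a (t * 2)) - 1 / ξ)
      (r := (2 ^ ξ)⁻¹) (inv_lt_one_of_one_lt₀ (Real.one_lt_rpow one_lt_two hξ)) hq ?_ ?_ ?_ ?_
    · filter_upwards [h.eventually_pos, (tendsto_mul_atTop two_pos).eventually h.eventually_pos]
        with t h1 h2
      positivity
    · have h1 := (((h.2 2 two_pos).add_const (1 / ξ)).mul hq).sub_const (1 / ξ)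
      convert h1 using 2
      have : (2 : ℝ) ^ ξ ≠ 0 := by positivity
      unfold boxCox
      rw [if_neg hξ.ne']
      field_simp
      ring
    · filter_upwards [h.eventually_pos, (tendsto_mul_atTop two_pos).eventually h.eventually_pos]
        with t h1 h2
      field_simp
      ring
    -- No regularity of a is available, so a lower bound for it on [T, 2T] comes from U: C * a t
    -- exceeds U(4t) - U(t), which is at least U(4T) - U(2T) > 0.
    · have h4 := (h.2 4 (by norm_num)).eventually_lt_const (lt_add_one _)
      obtain ⟨T0, hT0⟩ := eventually_atTop.1 h4
      have h2 := (tendsto_mul_atTop (two_pos)).eventually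
        ((h.2 2 two_pos).eventually_const_lt (boxCox_pos one_lt_two))
      filter_upwards [eventually_ge_atTop T0, eventually_gt_atTop 1, h2,
        (tendsto_mul_atTop two_pos).eventually h.eventually_pos] with T hT hT1 h3 h5
      set C := boxCox ξ 4 + 1
      have hC : 0 < C := by have := boxCox_pos (ξ := ξ) (x := 4) (by norm_num); positivity
      have hd : 0 < U (T * 2 * 2) - U (T * 2) := (div_pos_iff_of_pos_right h5).1 h3
      set d := U (T * 2 * 2) - U (T * 2)
      refine ⟨max |U T| |U (T * 2)| / (d / C) + |1 / ξ|, fun t ht => ?_⟩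
      refine (abs_sub _ _).trans ?_
      have ht1 : 1 < t := lt_of_lt_of_le hT1 ht.1
      have hat : 0 < a t := h.1 t ht1.le
      have hU1 : U T ≤ U t := hmono hT1 ht1 ht.1
      have hU2 : U t ≤ U (T * 2) := hmono ht1 (ht1.trans_le ht.2) ht.2
      have hU3 : U (T * 2 * 2) ≤ U (t * 4) :=
        hmono (by simp only [Set.mem_Ioi]; linarith) (by simp only [Set.mem_Ioi]; linarith)
          (by linarith [ht.1])
      have h6 := hT0 t (hT.trans ht.1)
      rw [div_lt_iff₀ hat] at h6
      have hda : d / C ≤ a t := by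
        rw [div_le_iff₀ hC]
        simp only [d]
        linarith
      rw [abs_div, abs_of_pos hat]
      gcongr
      exact abs_le_max_abs_abs hU1 hU2
  simpa using hE.add_const (1 / ξ)

/-- For `ξ < 0` the function `U - a / ξ` is Cauchy along `t * 2 ^ k`, at the scale of `a`. -/
lemma IsAuxiliary.abs_sub_le_of_neg (h : IsAuxiliary F ξ a) (hξ : ξ < 0) {ε : ℝ} (hε : 0 < ε) :
    ∀ᶠ t in atTop, Tendsto (fun k : ℕ => a (t * 2 ^ k)) atTop (𝓝 0) ∧
      ∀ k : ℕ, |(tailQuantile F (t * 2 ^ k) - a (t * 2 ^ k) / ξ) - (tailQuantile F t - a t / ξ)|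
        ≤ ε * a t := by
  set U := tailQuantile F
  have hq1 : (2 : ℝ) ^ ξ < 1 := Real.rpow_lt_one_of_one_lt_of_neg one_lt_two hξ
  obtain ⟨q, hq, hq1⟩ := exists_between hq1
  have hq0 : 0 < q := lt_trans (by positivity) hq
  have hV : Tendsto (fun t => ((U (t * 2) - a (t * 2) / ξ) - (U t - a t / ξ)) / a t) atTop
      (𝓝 0) := by
    have h1 := (h.2 2 two_pos).sub (((h.regularlyVarying.2 2 two_pos).sub_const 1).div_const ξ)
    have h0 : boxCox ξ 2 - (2 ^ ξ - 1) / ξ = 0 := by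
      unfold boxCox
      rw [if_neg hξ.ne, sub_self]
    rw [h0] at h1
    refine h1.congr' ?_
    filter_upwards [h.eventually_pos] with t ht
    field_simp
    ring
  -- The factor 1 - q is chosen so that the geometric series of increments sums to at most ε * a t.
  have hV' : ∀ᶠ t in atTop,
      |((U (t * 2) - a (t * 2) / ξ) - (U t - a t / ξ)) / a t| < ε * (1 - q) := by
    have := (tendsto_order.1 hV.abs).2 (ε * (1 - q))
    rw [abs_zero] at this
    exact this (mul_pos hε (by linarith))
  obtain ⟨T0, hT0⟩ := eventually_atTop.1
    (hV'.and ((h.regularlyVarying.2 2 two_pos).eventually_lt_const hq))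
  filter_upwards [eventually_ge_atTop T0, eventually_ge_atTop 1] with t ht ht1
  have hat := h.1 t ht1
  have hpow : ∀ k : ℕ, t ≤ t * 2 ^ k := fun k =>
    le_mul_of_one_le_right (by linarith) (one_le_pow₀ one_le_two)
  have hpos : ∀ k : ℕ, 0 < a (t * 2 ^ k) := fun k => h.1 _ (ht1.trans (hpow k))
  have key1 : ∀ k : ℕ, a (t * 2 ^ k) ≤ q ^ k * a t := by
    intro k
    induction k with
    | zero => simp
    | succ k ih =>
      have h2 := (hT0 _ (ht.trans (hpow k))).2
      rw [div_lt_iff₀ (hpos k)] at h2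
      rw [pow_succ, ← mul_assoc]
      calc _ ≤ q * a (t * 2 ^ k) := h2.le
        _ ≤ q * (q ^ k * a t) := by gcongr
        _ = _ := by ring
  refine ⟨?_, ?_⟩
  · refine squeeze_zero (fun k => (hpos k).le) key1 ?_
    simpa using (tendsto_pow_atTop_nhds_zero_of_lt_one hq0.le hq1).mul_const (a t)
  · have key2 : ∀ k : ℕ, |(U (t * 2 ^ k) - a (t * 2 ^ k) / ξ) - (U t - a t / ξ)|
        ≤ ε * (1 - q ^ k) * a t := by
      intro k
      induction k with
      | zero => simp
      | succ k ih =>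
        have h2 := (hT0 _ (ht.trans (hpow k))).1
        rw [abs_div, abs_of_pos (hpos k), div_lt_iff₀ (hpos k)] at h2
        rw [pow_succ, ← mul_assoc]
        refine (abs_sub_le _ (U (t * 2 ^ k) - a (t * 2 ^ k) / ξ) _).trans ?_
        have h3 : ε * (1 - q) * a (t * 2 ^ k) ≤ ε * (1 - q) * (q ^ k * a t) :=
          mul_le_mul_of_nonneg_left (key1 k) (mul_nonneg hε.le (by linarith))
        calc _ ≤ ε * (1 - q) * (q ^ k * a t) + ε * (1 - q ^ k) * a t := by linarith
          _ = _ := by ring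
    intro k
    refine (key2 k).trans ?_
    gcongr
    have : 0 ≤ q ^ k := by positivity
    nlinarith

/-- For ξ < 0 the function U - a/ξ dominates U, and it is bounded along t * 2 ^ k. -/
lemma IsAuxiliary.exists_bound_of_neg (h : IsAuxiliary F ξ a) (hξ : ξ < 0) :
    ∃ B, ∃ᶠ t in atTop, tailQuantile F t ≤ B := by
  obtain ⟨t, ⟨hlim, ht⟩, ht1⟩ :=
    ((h.abs_sub_le_of_neg hξ zero_lt_one).and (eventually_ge_atTop 1)).exists
  refine ⟨tailQuantile F t - a t / ξ + a t, ?_⟩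
  have htend : Tendsto (fun k : ℕ => t * 2 ^ k) atTop atTop :=
    (tendsto_pow_atTop_atTop_of_one_lt one_lt_two).const_mul_atTop (by linarith)
  refine htend.frequently (Eventually.frequently ?_)
  refine Eventually.of_forall fun k => ?_
  have h1 := (abs_le.1 (ht k)).2
  have h2 : 0 < a (t * 2 ^ k) :=
    h.1 _ (ht1.trans (le_mul_of_one_le_right (by linarith) (one_le_pow₀ one_le_two)))
  have h3 := div_neg_of_pos_of_neg h2 hξ
  linarith

lemma IsAuxiliary.tendsto_div_of_neg (h : IsAuxiliary F ξ a) (hξ : ξ < 0) {s : ℝ}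
    (hs : Tendsto (tailQuantile F) atTop (𝓝 s)) :
    Tendsto (fun t => (s - tailQuantile F t) / a t) atTop (𝓝 (-1 / ξ)) := by
  rw [Metric.tendsto_nhds]
  intro ε hε
  filter_upwards [h.abs_sub_le_of_neg hξ (half_pos hε), eventually_ge_atTop 1] with t ht ht1
  have hat := h.1 t ht1
  have htend : Tendsto (fun k : ℕ => t * 2 ^ k) atTop atTop :=
    (tendsto_pow_atTop_atTop_of_one_lt one_lt_two).const_mul_atTop (by linarith)
  -- Letting k → ∞ in the Cauchy estimate, where U → s and a → 0, compares s directly with U(t) -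
  -- a(t)/ξ.
  have h1 := le_of_tendsto
    ((((hs.comp htend).sub (ht.1.div_const ξ)).sub_const (tailQuantile F t - a t / ξ)).abs)
    (Eventually.of_forall ht.2)
  rw [zero_div, sub_zero] at h1
  have h2 : (s - tailQuantile F t) / a t - -1 / ξ = (s - (tailQuantile F t - a t / ξ)) / a t := by
    have := hξ.ne
    field_simp
    ring
  rw [Real.dist_eq, h2, abs_div, abs_of_pos hat, div_lt_iff₀ hat]
  nlinarith

/-- The logarithm is unbounded below: with x = e^(-(b+1)), U(t) exceeds U(tx) by at least b * a(t),
while U(tx) is eventually nonnegative. The finite-endpoint analogue uses x = e^(b+1) and U(tx) ≤ s.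
-/
lemma IsAuxiliary.tendsto_div_atTop_of_zero (h : IsAuxiliary F 0 a)
    (htop : Tendsto (tailQuantile F) atTop atTop) :
    Tendsto (fun t => tailQuantile F t / a t) atTop atTop := by
  rw [tendsto_atTop]
  intro b
  have h0 : boxCox 0 (Real.exp (-(b + 1))) < -b := by
    rw [boxCox, if_pos rfl, Real.log_exp]
    linarith
  have h1 := (h.2 (Real.exp (-(b + 1))) (Real.exp_pos _)).eventually_lt_const h0
  filter_upwards [h.eventually_pos, h1,
    (htop.comp (tendsto_mul_atTop (Real.exp_pos (-(b + 1))))).eventually_ge_atTop 0]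
    with t h2 h3 h4
  have h4 : 0 ≤ tailQuantile F (t * Real.exp (-(b + 1))) := h4
  rw [div_lt_iff₀ h2] at h3
  rw [le_div_iff₀ h2]
  linarith

lemma IsAuxiliary.tendsto_gap_div_atTop_of_zero (h : IsAuxiliary F 0 a) {s : ℝ}
    (hs : ∀ᶠ t in atTop, tailQuantile F t ≤ s) :
    Tendsto (fun t => (s - tailQuantile F t) / a t) atTop atTop := by
  rw [tendsto_atTop]
  intro b
  have h0 : b < boxCox 0 (Real.exp (b + 1)) := by
    rw [boxCox, if_pos rfl, Real.log_exp]
    linarith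
  have h1 := (h.2 (Real.exp (b + 1)) (Real.exp_pos _)).eventually_const_lt h0
  filter_upwards [h.eventually_pos, h1,
    (tendsto_mul_atTop (Real.exp_pos (b + 1))).eventually hs] with t h2 h3 h4
  rw [lt_div_iff₀ h2] at h3
  rw [le_div_iff₀ h2]
  linarith

/-! ### Potter bounds and dominated convergence -/

/-- The upper Potter bound for monotone functions. -/
lemma RegularlyVarying.exists_le_of_monotoneOn {k : ℝ → ℝ} {ρ β : ℝ} (hk : RegularlyVarying ρ k)
    (hmono : MonotoneOn k (Set.Ioi 1)) (hβ0 : 0 ≤ β) (hβ : ρ < β) :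
    ∀ᶠ t in atTop, ∀ y, 1 ≤ y → k (t * y) ≤ 2 ^ β * y ^ β * k t := by
  have h2 := (hk.2 2 two_pos).eventually_lt_const
    (Real.rpow_lt_rpow_of_exponent_lt one_lt_two hβ)
  obtain ⟨T0, hT0⟩ := eventually_atTop.1 (h2.and hk.1)
  filter_upwards [eventually_ge_atTop T0, eventually_gt_atTop 1] with t ht ht1 y hy
  have hpow : ∀ j : ℕ, t ≤ t * 2 ^ j := fun j =>
    le_mul_of_one_le_right (by linarith) (one_le_pow₀ one_le_two)
  have key : ∀ j : ℕ, k (t * 2 ^ j) ≤ (2 ^ β) ^ j * k t := by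
    intro j
    induction j with
    | zero => simp
    | succ j ih =>
      obtain ⟨h3, h4⟩ := hT0 _ (ht.trans (hpow j))
      rw [div_lt_iff₀ h4] at h3
      rw [pow_succ, ← mul_assoc]
      calc _ ≤ (2 : ℝ) ^ β * k (t * 2 ^ j) := h3.le
        _ ≤ 2 ^ β * ((2 ^ β) ^ j * k t) := by gcongr
        _ = _ := by ring
  -- Rounding y up to the next power of two costs the constant 2 ^ β.
  obtain ⟨j, hj1, hj2⟩ := exists_nat_pow_near hy one_lt_two
  have hkt := (hT0 t ht).2
  calc k (t * y) ≤ k (t * 2 ^ (j + 1)) := by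
        refine hmono ?_ ?_ (by gcongr)
        · simp only [Set.mem_Ioi]; nlinarith
        · exact ht1.trans_le (hpow _)
    _ ≤ (2 ^ β) ^ (j + 1) * k t := key _
    _ = 2 ^ β * (2 ^ j : ℝ) ^ β * k t := by
        rw [← Real.rpow_natCast 2 j, ← Real.rpow_mul two_pos.le, mul_comm (j : ℝ) β,
          Real.rpow_mul two_pos.le, Real.rpow_natCast]
        ring
    _ ≤ _ := by gcongr

/-- The lower Potter bound for bounded antitone functions, on the whole half-line `(1, ∞)`. -/
lemma RegularlyVarying.exists_le_of_antitoneOn {k : ℝ → ℝ} {ρ γ M : ℝ}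
    (hk : RegularlyVarying ρ k) (hanti : AntitoneOn k (Set.Ioi 1)) (hM : ∀ t, 1 < t → k t ≤ M)
    (hγ0 : 0 ≤ γ) (hγ : -ρ < γ) :
    ∃ C, 0 ≤ C ∧ ∀ᶠ t in atTop, ∀ s, 1 ≤ s → 1 < t / s → k (t / s) ≤ C * s ^ γ * k t := by
  have h0 : (2⁻¹ : ℝ) ^ ρ < 2 ^ γ := by
    rw [Real.inv_rpow two_pos.le, ← Real.rpow_neg two_pos.le]
    exact Real.rpow_lt_rpow_of_exponent_lt one_lt_two hγ
  have h2 := (hk.2 2⁻¹ (by norm_num)).eventually_lt_const h0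
  obtain ⟨T0, hT0⟩ := eventually_atTop.1 (h2.and hk.1)
  -- With T ≥ 4, halving once more below T stays inside (1, ∞), where k is antitone.
  set T := max T0 4
  have hT4 : 4 ≤ T := le_max_right _ _
  have hTT : T0 ≤ T := le_max_left _ _
  have hkT := (hT0 T hTT).2
  have hM0 : 0 ≤ M := hkT.le.trans (hM T (by linarith))
  have step : ∀ t, T ≤ t → ∀ j : ℕ, T ≤ t / 2 ^ j →
      k (t / 2 ^ (j + 1)) ≤ (2 ^ γ) ^ (j + 1) * k t := by
    intro t ht j
    induction j with
    | zero =>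
      intro _
      obtain ⟨h3, h4⟩ := hT0 t (hTT.trans ht)
      rw [div_lt_iff₀ h4] at h3
      simpa [div_eq_mul_inv] using h3.le
    | succ j ih =>
      intro hj
      have hj' : T ≤ t / 2 ^ j := by
        refine hj.trans ?_
        have : (2 : ℝ) ^ j ≤ 2 ^ (j + 1) := pow_le_pow_right₀ one_le_two (Nat.le_succ j)
        gcongr
        linarith
      obtain ⟨h3, h4⟩ := hT0 _ (hTT.trans hj)
      rw [div_lt_iff₀ h4] at h3
      have he : t / 2 ^ (j + 1 + 1) = t / 2 ^ (j + 1) * 2⁻¹ := by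
        rw [pow_succ _ (j + 1)]; field_simp
      rw [he]
      calc _ ≤ (2 : ℝ) ^ γ * k (t / 2 ^ (j + 1)) := h3.le
        _ ≤ 2 ^ γ * ((2 ^ γ) ^ (j + 1) * k t) := by gcongr; exact ih hj'
        _ = _ := by ring
  have key : ∀ t, T ≤ t → ∀ s, 1 ≤ s → T ≤ t / s → k (t / s) ≤ 2 ^ γ * s ^ γ * k t := by
    intro t ht s hs hts
    have hs0 : 0 < s := by linarith
    have ht0 : 0 < t := by linarith
    obtain ⟨j, hj1, hj2⟩ := exists_nat_pow_near hs one_lt_two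
    have hle : t / s ≤ t / 2 ^ j := by gcongr
    have hj3 : T ≤ t / 2 ^ j := hts.trans hle
    have hkt := (hT0 t (hTT.trans ht)).2
    calc k (t / s) ≤ k (t / 2 ^ (j + 1)) := by
          refine hanti ?_ ?_ (by gcongr)
          · have : t / 2 ^ (j + 1) = t / 2 ^ j / 2 := by rw [pow_succ]; field_simp
            simp only [Set.mem_Ioi]
            rw [this]
            linarith
          · simp only [Set.mem_Ioi]; linarith
      _ ≤ (2 ^ γ) ^ (j + 1) * k t := step t ht j hj3
      _ = 2 ^ γ * (2 ^ j : ℝ) ^ γ * k t := by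
          rw [← Real.rpow_natCast 2 j, ← Real.rpow_mul two_pos.le, mul_comm (j : ℝ) γ,
            Real.rpow_mul two_pos.le, Real.rpow_natCast]
          ring
      _ ≤ _ := by gcongr
  have h1C : 1 ≤ 1 + M / k T := by
    have : 0 ≤ M / k T := by positivity
    linarith
  refine ⟨(1 + M / k T) * 2 ^ γ, by positivity, ?_⟩
  filter_upwards [eventually_ge_atTop T] with t ht s hs hts
  have hkt := (hT0 t (hTT.trans ht)).2
  have hs0 : 0 < s := by linarith
  have ht0 : 0 < t := by linarith
  rcases le_or_gt T (t / s) with hcase | hcase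
  · refine (key t ht s hs hcase).trans ?_
    gcongr
    exact le_mul_of_one_le_left (by positivity) h1C
  -- Below the threshold T only k ≤ M is known; M is compared with k T, and the bound already proved
  -- applies at s = t / T, which is at most the given s.
  · have h1 : 1 ≤ t / T := by rwa [one_le_div (by linarith)]
    have h3 : t / (t / T) = T := by field_simp
    have h2 := key t ht (t / T) h1 h3.ge
    rw [h3] at h2
    have h4 : t / T ≤ s := by
      rw [div_lt_iff₀ hs0] at hcase
      rw [div_le_iff₀ (by linarith)]
      linarith
    calc k (t / s) ≤ M := hM _ hts
      _ = M / k T * k T := by field_simp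
      _ ≤ M / k T * (2 ^ γ * (t / T) ^ γ * k t) := by gcongr
      _ ≤ (1 + M / k T) * (2 ^ γ * s ^ γ * k t) := by gcongr; linarith
      _ = _ := by ring

/-! ### Dominated convergence to the gamma integral -/

lemma one_sub_div_pow_le_exp {n : ℕ} (hn : 2 ≤ n) {s : ℝ} (hs : s ∈ Set.Ioo 0 (n : ℝ)) :
    (1 - s / n) ^ (n - 1) ≤ Real.exp (-(1 / 2) * s) := by
  have hn0 : (0 : ℝ) < n := by exact_mod_cast (by omega : 0 < n)
  have hn2 : (2 : ℝ) ≤ n := by exact_mod_cast hn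
  have h1 : 0 ≤ 1 - s / n := sub_nonneg.2 ((div_le_one hn0).2 hs.2.le)
  calc _ ≤ (Real.exp (-(s / n))) ^ (n - 1) := by
        gcongr
        exact Real.one_sub_le_exp_neg _
    _ = Real.exp (((n - 1 : ℕ) : ℝ) * (-(s / n))) := (Real.exp_nat_mul _ _).symm
    _ ≤ _ := by
        rw [Real.exp_le_exp, Nat.cast_sub (by omega), Nat.cast_one]
        have h2 : ((n : ℝ) - 1) * -(s / n) = -(((n : ℝ) - 1) / n) * s := by field_simp
        rw [h2]
        have h3 : 1 / 2 ≤ ((n : ℝ) - 1) / n := by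
          rw [div_le_div_iff₀ two_pos hn0]; linarith
        nlinarith [hs.1]

lemma tendsto_one_sub_div_pow_pred (s : ℝ) :
    Tendsto (fun n : ℕ => (1 - s / n) ^ (n - 1)) atTop (𝓝 (Real.exp (-s))) := by
  have h1 := Real.tendsto_one_add_div_pow_exp (-s)
  have h2 : Tendsto (fun n : ℕ => 1 + -s / (n : ℝ)) atTop (𝓝 1) := by
    simpa using (tendsto_const_div_atTop_nhds_zero_nat (-s)).const_add 1
  have h3 := h1.div h2 one_ne_zero
  rw [div_one] at h3
  refine h3.congr' ?_
  filter_upwards [h2.eventually_ne one_ne_zero, eventually_ge_atTop 1] with n hn hn1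
  have h4 : 1 - s / (n : ℝ) = 1 + -s / n := by ring
  simp only [Pi.div_apply]
  rw [h4, div_eq_iff hn, ← pow_succ, Nat.sub_add_cancel hn1]

/-- The majorant is C (s^(-β) + s^γ) e^(-s/2); β < 1 and γ > -1 make it integrable at 0. -/
lemma tendsto_integral_of_regularlyVarying {k : ℝ → ℝ} {ρ β γ C : ℝ} (hρ : ρ < 1)
    (hk : RegularlyVarying ρ k)
    (hmeas : ∀ n : ℕ, AEStronglyMeasurable (fun s : ℝ => k (n / s))
      (volume.restrict (Set.Ioo 0 (n : ℝ))))
    (hβ : β < 1) (hγ : -1 < γ)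
    (hb : ∀ᶠ n : ℕ in atTop, ∀ s ∈ Set.Ioo 0 (n : ℝ),
      |k (n / s)| ≤ C * (s ^ (-β) + s ^ γ) * k n) :
    Tendsto (fun n : ℕ => (∫ s in Set.Ioo 0 (n : ℝ), (1 - s / n) ^ (n - 1) * k (n / s)) / k n)
      atTop (𝓝 (Real.Gamma (1 - ρ))) := by
  have hpos : ∀ᶠ n : ℕ in atTop, 0 < k n := tendsto_natCast_atTop_atTop.eventually hk.1
  have hΓ : Real.Gamma (1 - ρ) = ∫ s in Set.Ioi (0 : ℝ), Real.exp (-s) * s ^ (-ρ) := by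
    rw [Real.Gamma_eq_integral (by linarith)]
    ring_nf
  set f : ℕ → ℝ → ℝ := fun n => (Set.Ioo 0 (n : ℝ)).indicator
    fun s => (1 - s / n) ^ (n - 1) * k (n / s) / k n
  have hf : ∀ n : ℕ, ∫ s in Set.Ioi (0 : ℝ), f n s =
      (∫ s in Set.Ioo 0 (n : ℝ), (1 - s / n) ^ (n - 1) * k (n / s)) / k n := by
    intro n
    rw [setIntegral_indicator measurableSet_Ioo, Set.inter_eq_self_of_subset_right
      (fun x hx => hx.1), integral_div]
  simp_rw [← hf]
  rw [hΓ]
  refine tendsto_integral_filter_of_dominated_convergence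
    (fun s => C * (s ^ (-β) + s ^ γ) * Real.exp (-(1 / 2) * s)) ?_ ?_ ?_ ?_
  · refine Eventually.of_forall fun n => ?_
    refine AEStronglyMeasurable.mono_measure ?_ Measure.restrict_le_self
    refine (aestronglyMeasurable_indicator_iff measurableSet_Ioo).2 ?_
    refine ((AEMeasurable.mul ?_ (hmeas n).aemeasurable).div_const _).aestronglyMeasurable
    exact (by fun_prop : Continuous fun s : ℝ => (1 - s / n) ^ (n - 1)).aemeasurable
  · filter_upwards [hb, hpos, eventually_ge_atTop 2] with n h1 h2 h3
    refine ae_restrict_of_forall_mem measurableSet_Ioi fun s hs => ?_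
    have hs0 : 0 < s := hs
    by_cases hsn : s ∈ Set.Ioo 0 (n : ℝ)
    · have hn0 : (0 : ℝ) < n := hsn.1.trans hsn.2
      have h4 : 0 ≤ 1 - s / n := sub_nonneg.2 ((div_le_one hn0).2 hsn.2.le)
      simp only [f, Set.indicator_of_mem hsn, Real.norm_eq_abs]
      rw [abs_div, abs_of_pos h2, abs_mul, abs_of_nonneg (pow_nonneg h4 _), div_le_iff₀ h2]
      calc _ ≤ Real.exp (-(1 / 2) * s) * (C * (s ^ (-β) + s ^ γ) * k n) :=
            mul_le_mul (one_sub_div_pow_le_exp h3 hsn) (h1 s hsn) (abs_nonneg _)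
              (Real.exp_pos _).le
        _ = _ := by ring
    · simp only [f, Set.indicator_of_notMem hsn, norm_zero]
      -- Outside (0, n) the majorant only has to be nonnegative; this is read off from `hb` at some
      -- m > s, as C has no assumed sign.
      obtain ⟨m, hm1, hm2, hm3, hm4⟩ := (hb.and (hpos.and ((eventually_ge_atTop 2).and
        (tendsto_natCast_atTop_atTop.eventually (eventually_gt_atTop s))))).exists
      have h5 := (abs_nonneg _).trans (hm1 s ⟨hs0, hm4⟩)
      have h6 := nonneg_of_mul_nonneg_left h5 hm2
      positivity
  · have h1 : ∀ p : ℝ, -1 < p →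
        IntegrableOn (fun s : ℝ => s ^ p * Real.exp (-(1 / 2) * s)) (Set.Ioi 0) := by
      intro p hp
      simpa using integrableOn_rpow_mul_exp_neg_mul_rpow (b := 1 / 2) hp one_pos (by norm_num)
    have h2 := ((h1 (-β) (by linarith)).add (h1 γ hγ)).const_mul C
    refine Integrable.congr h2 (Eventually.of_forall fun s => ?_)
    simp only [Pi.add_apply]
    ring
  · refine ae_restrict_of_forall_mem measurableSet_Ioi fun s hs => ?_
    have hs0 : 0 < s := hs
    have h1 := (hk.2 s⁻¹ (inv_pos.2 hs0)).comp tendsto_natCast_atTop_atTop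
    rw [Real.inv_rpow hs0.le, ← Real.rpow_neg hs0.le] at h1
    refine ((tendsto_one_sub_div_pow_pred s).mul h1).congr' ?_
    filter_upwards [tendsto_natCast_atTop_atTop.eventually (eventually_gt_atTop s)] with n hn
    have hsn : s ∈ Set.Ioo 0 (n : ℝ) := ⟨hs0, hn⟩
    simp only [f, Set.indicator_of_mem hsn, Function.comp_apply, div_eq_mul_inv, mul_assoc]

/-- The Potter bound controls s ≤ 1, where n/s ≥ n, and monotonicity controls s ≥ 1. In the antitone
version the roles are exchanged. -/
lemma RegularlyVarying.tendsto_integral_of_monotoneOn {k : ℝ → ℝ} {ρ : ℝ}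
    (hk : RegularlyVarying ρ k) (hρ : ρ < 1) (hmono : MonotoneOn k (Set.Ioi 1))
    (hk0 : ∀ t, 0 ≤ k t) :
    Tendsto (fun n : ℕ => (∫ s in Set.Ioo 0 (n : ℝ), (1 - s / n) ^ (n - 1) * k (n / s)) / k n)
      atTop (𝓝 (Real.Gamma (1 - ρ))) := by
  obtain ⟨β, hβ, hβ1⟩ := exists_between (max_lt hρ zero_lt_one)
  obtain ⟨hρβ, hβ0⟩ := max_lt_iff.1 hβ
  refine tendsto_integral_of_regularlyVarying (β := β) (γ := 0) (C := 2 ^ β) hρ hk (fun n => ?_)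
    hβ1 (by norm_num) ?_
  · refine (aemeasurable_restrict_of_antitoneOn measurableSet_Ioo ?_).aestronglyMeasurable
    intro s hs t ht hst
    refine hmono ?_ ?_ ?_
    · exact (one_lt_div ht.1).2 ht.2
    · exact (one_lt_div hs.1).2 hs.2
    · exact div_le_div_of_nonneg_left (hs.1.trans hs.2).le hs.1 hst
  · filter_upwards [tendsto_natCast_atTop_atTop.eventually
      (hk.exists_le_of_monotoneOn hmono hβ0.le hρβ), eventually_gt_atTop 1] with n hn hn1 s hs
    have hs0 : 0 < s := hs.1
    have hn1' : (1 : ℝ) < n := by exact_mod_cast hn1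
    rw [abs_of_nonneg (hk0 _), Real.rpow_zero]
    have h1 : (1 : ℝ) ≤ 2 ^ β := Real.one_le_rpow one_le_two hβ0.le
    have h2 := hk0 (n : ℝ)
    rcases le_total s 1 with h | h
    · have := hn s⁻¹ ((one_le_inv₀ hs0).2 h)
      rw [Real.inv_rpow hs0.le, ← Real.rpow_neg hs0.le, ← div_eq_mul_inv] at this
      refine this.trans ?_
      gcongr
      linarith
    · have h3 : k (n / s) ≤ k n :=
        hmono ((one_lt_div hs0).2 hs.2) hn1' (div_le_self (by linarith) h)
      refine h3.trans (le_mul_of_one_le_left h2 ?_)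
      have : 0 ≤ s ^ (-β) := by positivity
      nlinarith

lemma RegularlyVarying.tendsto_integral_of_antitoneOn {k : ℝ → ℝ} {ρ M : ℝ}
    (hk : RegularlyVarying ρ k) (hρ : ρ < 1) (hanti : AntitoneOn k (Set.Ioi 1))
    (hk0 : ∀ t, 1 < t → 0 ≤ k t) (hM : ∀ t, 1 < t → k t ≤ M) :
    Tendsto (fun n : ℕ => (∫ s in Set.Ioo 0 (n : ℝ), (1 - s / n) ^ (n - 1) * k (n / s)) / k n)
      atTop (𝓝 (Real.Gamma (1 - ρ))) := by
  obtain ⟨γ, hγ⟩ := exists_gt (max (-ρ) 0)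
  obtain ⟨hργ, hγ0⟩ := max_lt_iff.1 hγ
  obtain ⟨C, hC, hbound⟩ := hk.exists_le_of_antitoneOn hanti hM hγ0.le hργ
  refine tendsto_integral_of_regularlyVarying (β := 0) (γ := γ) (C := 1 + C) hρ hk (fun n => ?_)
    zero_lt_one (by linarith) ?_
  · refine (aemeasurable_restrict_of_monotoneOn measurableSet_Ioo ?_).aestronglyMeasurable
    intro s hs t ht hst
    refine hanti ?_ ?_ ?_
    · exact (one_lt_div ht.1).2 ht.2
    · exact (one_lt_div hs.1).2 hs.2
    · exact div_le_div_of_nonneg_left (hs.1.trans hs.2).le hs.1 hst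
  · filter_upwards [tendsto_natCast_atTop_atTop.eventually hbound, eventually_gt_atTop 1]
      with n hn hn1 s hs
    have hs0 : 0 < s := hs.1
    have hn1' : (1 : ℝ) < n := by exact_mod_cast hn1
    have h1 : (1 : ℝ) < n / s := (one_lt_div hs0).2 hs.2
    rw [abs_of_nonneg (hk0 _ h1), neg_zero, Real.rpow_zero]
    have h2 := hk0 (n : ℝ) hn1'
    have h3 : 0 ≤ s ^ γ := by positivity
    rcases le_total s 1 with h | h
    · have h4 : k (n / s) ≤ k n := hanti hn1' h1 (le_div_self (by linarith) hs0 h)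
      refine h4.trans (le_mul_of_one_le_left h2 ?_)
      nlinarith
    · refine (hn s h h1).trans ?_
      gcongr <;> linarith

/-! ### The law of the maximum -/

section Maximum

variable {Ω : Type*} {X : ℕ → Ω → ℝ}

lemma best_le_iff {n : ℕ} (hn : n ≠ 0) (ω : Ω) (y : ℝ) :
    best X n ω ≤ y ↔ ∀ i ∈ Finset.range n, X i ω ≤ y := by
  have : Nonempty (Fin n) := ⟨⟨0, Nat.pos_of_ne_zero hn⟩⟩
  rw [best, ciSup_le_iff (Set.finite_range _).bddAbove]
  exact ⟨fun h i hi => h ⟨i, Finset.mem_range.1 hi⟩, fun h i => h i (Finset.mem_range.2 i.2)⟩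

variable [MeasurableSpace Ω] {P : Measure Ω}

lemma measurable_best (hmeas : ∀ i, Measurable (X i)) (n : ℕ) : Measurable (best X n) :=
  Measurable.iSup fun i : Fin n => hmeas i

variable [IsProbabilityMeasure P]

lemma map_best_Iic (hmeas : ∀ i, Measurable (X i)) (hindep : iIndepFun X P)
    (hident : ∀ i, IdentDistrib (X i) (X 0) P P) {n : ℕ} (hn : n ≠ 0) (y : ℝ) :
    P.map (best X n) (Set.Iic y) = ENNReal.ofReal (cdf (P.map (X 0)) y ^ n) := by
  have : IsProbabilityMeasure (P.map (X 0)) :=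
    Measure.isProbabilityMeasure_map (hmeas 0).aemeasurable
  rw [Measure.map_apply (measurable_best hmeas n) measurableSet_Iic]
  have h1 : best X n ⁻¹' Set.Iic y = ⋂ i ∈ Finset.range n, X i ⁻¹' Set.Iic y := by
    ext ω
    simp only [Set.mem_preimage, Set.mem_Iic, best_le_iff hn, Set.mem_iInter]
  have h2 : ∀ i, P (X i ⁻¹' Set.Iic y) = ENNReal.ofReal (cdf (P.map (X 0)) y) := by
    intro i
    rw [ofReal_cdf, ← (hident i).map_eq, Measure.map_apply (hmeas i) measurableSet_Iic]
  rw [h1, hindep.measure_inter_preimage_eq_mul _ fun _ _ => measurableSet_Iic]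
  simp_rw [h2]
  rw [Finset.prod_const, Finset.card_range, ENNReal.ofReal_pow (cdf_nonneg _ _)]

/-- This identifies the density as that of n(1 - V), with V the maximum of n uniform variables; p
will be F(y). -/
lemma lintegral_one_sub_div_pow {n : ℕ} (hn : n ≠ 0) {p : ℝ} (hp0 : 0 ≤ p) :
    ∫⁻ s in Set.Ioc (n * (1 - p)) (n : ℝ), ENNReal.ofReal ((1 - s / n) ^ (n - 1)) =
      ENNReal.ofReal (p ^ n) := by
  have hn0 : (0 : ℝ) < n := by exact_mod_cast Nat.pos_of_ne_zero hn
  have hle : n * (1 - p) ≤ (n : ℝ) := mul_le_of_le_one_right hn0.le (by linarith)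
  have hcont : Continuous fun s : ℝ => (1 - s / n) ^ (n - 1) := by fun_prop
  rw [← ofReal_integral_eq_lintegral_ofReal]
  · rw [← intervalIntegral.integral_of_le hle]
    congr 1
    have hderiv : ∀ s : ℝ, HasDerivAt (fun s : ℝ => -(1 - s / n) ^ n) ((1 - s / n) ^ (n - 1)) s := by
      intro s
      have h1 := ((((hasDerivAt_id s).div_const (n : ℝ)).const_sub 1).pow n).neg
      refine h1.congr_deriv ?_
      rw [mul_neg, neg_neg, id, mul_right_comm, mul_one_div_cancel hn0.ne', one_mul]
    rw [intervalIntegral.integral_eq_sub_of_hasDerivAt (fun s _ => hderiv s)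
      (hcont.intervalIntegrable _ _), div_self hn0.ne', mul_div_cancel_left₀ _ hn0.ne', sub_self,
      zero_pow hn]
    ring
  · exact (hcont.integrableOn_Icc).mono_set Set.Ioc_subset_Icc_self
  · refine ae_restrict_of_forall_mem measurableSet_Ioc fun s hs => ?_
    exact pow_nonneg (sub_nonneg.2 ((div_le_one hn0).2 hs.2)) _

lemma aemeasurable_tailQuantile_div (μ : Measure ℝ) (n : ℕ) :
    AEMeasurable (fun s : ℝ => tailQuantile (cdf μ) (n / s))
      (volume.restrict (Set.Ioo 0 (n : ℝ))) := by
  refine aemeasurable_restrict_of_antitoneOn measurableSet_Ioo ?_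
  intro s hs t ht hst
  refine monotoneOn_tailQuantile μ ?_ ?_ ?_
  · exact (one_lt_div ht.1).2 ht.2
  · exact (one_lt_div hs.1).2 hs.2
  · exact div_le_div_of_nonneg_left (hs.1.trans hs.2).le hs.1 hst

/-- If `S` has density `(1 - s / n) ^ (n - 1)` on `(0, n)`, then `U (n / S)` is distributed like
the maximum of `n` independent observations. -/
lemma map_best_eq (hmeas : ∀ i, Measurable (X i)) (hindep : iIndepFun X P)
    (hident : ∀ i, IdentDistrib (X i) (X 0) P P) {n : ℕ} (hn : n ≠ 0) :
    P.map (best X n) = ((volume.restrict (Set.Ioo 0 (n : ℝ))).withDensity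
      fun s => ENNReal.ofReal ((1 - s / n) ^ (n - 1))).map
        fun s => tailQuantile (cdf (P.map (X 0))) (n / s) := by
  have : IsProbabilityMeasure (P.map (best X n)) :=
    Measure.isProbabilityMeasure_map (measurable_best hmeas n).aemeasurable
  have hn0 : (0 : ℝ) < n := by exact_mod_cast Nat.pos_of_ne_zero hn
  refine Measure.ext_of_Iic _ _ fun y => ?_
  set μ := P.map (X 0)
  rw [map_best_Iic hmeas hindep hident hn, Measure.map_apply_of_aemeasurable
    ((aemeasurable_tailQuantile_div μ n).mono_ac (withDensity_absolutelyContinuous _ _))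
    measurableSet_Iic, withDensity_apply', Measure.restrict_restrict' measurableSet_Ioo,
    ← lintegral_one_sub_div_pow hn (cdf_nonneg μ y)]
  have hset : (fun s : ℝ => tailQuantile (cdf μ) (n / s)) ⁻¹' Set.Iic y ∩ Set.Ioo 0 (n : ℝ) =
      Set.Ici (n * (1 - cdf μ y)) ∩ Set.Ioo 0 (n : ℝ) := by
    ext s
    simp only [Set.mem_inter_iff, Set.mem_preimage, Set.mem_Iic, Set.mem_Ici,
      and_congr_left_iff]
    intro hs
    rw [tailQuantile_le_iff ((one_lt_div hs.1).2 hs.2), div_mul_eq_mul_div, div_le_one hs.1]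
  rw [hset]
  have hc : 0 ≤ n * (1 - cdf μ y) := mul_nonneg hn0.le (sub_nonneg.2 (cdf_le_one μ y))
  refine setLIntegral_congr ?_
  have h1 : Set.Ioo (n * (1 - cdf μ y)) (n : ℝ) ≤ᵐ[volume]
      (Set.Ici (n * (1 - cdf μ y)) ∩ Set.Ioo 0 (n : ℝ) : Set ℝ) :=
    LE.le.eventuallyLE fun s hs => ⟨hs.1.le, hc.trans_lt hs.1, hs.2⟩
  have h2 : (Set.Ici (n * (1 - cdf μ y)) ∩ Set.Ioo 0 (n : ℝ) : Set ℝ) ≤ᵐ[volume]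
      Set.Icc (n * (1 - cdf μ y)) (n : ℝ) :=
    LE.le.eventuallyLE fun s hs => ⟨hs.1, hs.2.2.le⟩
  exact Ioc_ae_eq_Icc.trans ((Ioo_ae_eq_Icc.symm.le.trans h1).antisymm h2)

lemma integral_comp_best (hmeas : ∀ i, Measurable (X i)) (hindep : iIndepFun X P)
    (hident : ∀ i, IdentDistrib (X i) (X 0) P P) {n : ℕ} (hn : n ≠ 0) {h : ℝ → ℝ}
    (hh : Measurable h) :
    ∫ ω, h (best X n ω) ∂P = ∫ s in Set.Ioo 0 (n : ℝ),
      (1 - s / n) ^ (n - 1) * h (tailQuantile (cdf (P.map (X 0))) (n / s)) := by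
  have hn0 : (0 : ℝ) < n := by exact_mod_cast Nat.pos_of_ne_zero hn
  rw [← integral_map (measurable_best hmeas n).aemeasurable hh.aestronglyMeasurable,
    map_best_eq hmeas hindep hident hn, integral_map
      ((aemeasurable_tailQuantile_div _ n).mono_ac (withDensity_absolutelyContinuous _ _))
      hh.aestronglyMeasurable,
    integral_withDensity_eq_integral_toReal_smul (by fun_prop)
      (Eventually.of_forall fun _ => ENNReal.ofReal_lt_top)]
  refine setIntegral_congr_fun measurableSet_Ioo fun s hs => ?_
  have : 0 ≤ 1 - s / n := sub_nonneg.2 ((div_le_one hn0).2 hs.2.le)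
  simp only [smul_eq_mul]
  rw [ENNReal.toReal_ofReal (pow_nonneg this _)]

lemma ae_best_le (hmeas : ∀ i, Measurable (X i)) (hindep : iIndepFun X P)
    (hident : ∀ i, IdentDistrib (X i) (X 0) P P) {n : ℕ} (hn : n ≠ 0) {s : ℝ}
    (hs : cdf (P.map (X 0)) s = 1) : ∀ᵐ ω ∂P, best X n ω ≤ s := by
  have h1 := map_best_Iic hmeas hindep hident hn s
  rw [hs, one_pow, ENNReal.ofReal_one,
    Measure.map_apply (measurable_best hmeas n) measurableSet_Iic] at h1
  exact (prob_compl_eq_zero_iff ((measurable_best hmeas n) measurableSet_Iic)).2 h1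

end Maximum

/-! ### The limit law determines an auxiliary function -/

lemma _root_.Set.Countable.exists_between_notMem {B : Set ℝ} (hB : B.Countable) {x y : ℝ}
    (h : x < y) : ∃ z, z ∉ B ∧ x < z ∧ z < y := by
  obtain ⟨z, hz, h1, h2⟩ := (hB.dense_compl ℝ).exists_between h
  exact ⟨z, hz, h1, h2⟩

lemma _root_.Set.Countable.frequently_notMem_nhdsGT {B : Set ℝ} (hB : B.Countable) (x : ℝ) :
    ∃ᶠ ε in 𝓝[>] x, ε ∉ B := by
  intro h
  obtain ⟨u, hu, hsub⟩ := mem_nhdsGT_iff_exists_Ioo_subset.1 h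
  obtain ⟨z, hz, h1, h2⟩ := hB.exists_between_notMem hu
  exact hsub ⟨h1, h2⟩ hz

lemma tendsto_add_mul_nhdsGT (c : ℝ) {m : ℝ} (hm : 0 < m) :
    Tendsto (fun ε : ℝ => c + m * ε) (𝓝[>] 0) (𝓝[>] c) := by
  refine tendsto_nhdsWithin_iff.2 ⟨?_, ?_⟩
  · have : Continuous fun ε : ℝ => c + m * ε := by fun_prop
    have h := this.tendsto 0
    rw [mul_zero, add_zero] at h
    exact h.mono_left nhdsWithin_le_nhds
  · filter_upwards [self_mem_nhdsWithin] with ε hε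
    have : 0 < m * ε := mul_pos hm hε
    simp only [Set.mem_Ioi]
    linarith

lemma _root_.Set.Countable.preimage_add_mul {B : Set ℝ} (hB : B.Countable) (c : ℝ) {m : ℝ}
    (hm : m ≠ 0) : ((fun ε : ℝ => c + m * ε) ⁻¹' B).Countable :=
  hB.preimage fun _ _ h => mul_left_cancel₀ hm (add_left_cancel h)

/-- `(exp (ξ * s) - 1) / ξ`, read as `s` when `ξ = 0`. -/
noncomputable def boxCoxExp (ξ s : ℝ) : ℝ := if ξ = 0 then s else (Real.exp (ξ * s) - 1) / ξ

lemma boxCoxExp_log (ξ : ℝ) {x : ℝ} (hx : 0 < x) : boxCoxExp ξ (Real.log x) = boxCox ξ x := by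
  unfold boxCox boxCoxExp
  rw [Real.rpow_def_of_pos hx, mul_comm ξ]

/-- The solutions of the functional equation of the extremal types theorem. -/
lemma exists_eq_boxCoxExp {k : ℝ → ℝ} {r : ℝ} (hr : 0 < r) (h0 : k 0 = 0) (hkr : k r = 1)
    (hcont : ContinuousAt k 0)
    (hfe : ∀ s s', k (s + s') - k s = k s' * (k (s + r) - k s)) :
    Continuous k ∧ ∃ ξ c : ℝ, 0 < c ∧ ∀ s, k s = c * boxCoxExp ξ s := by
  have hk : Continuous k := by
    refine continuous_iff_continuousAt.2 fun s => ?_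
    have h1 : Tendsto (fun x => k (x - s)) (𝓝 s) (𝓝 0) := by
      have h2 : Tendsto (fun x : ℝ => x - s) (𝓝 s) (𝓝 0) := by
        have : Continuous fun x : ℝ => x - s := by fun_prop
        simpa using this.tendsto s
      have h3 : Tendsto k (𝓝 0) (𝓝 0) := by
        have := hcont.tendsto
        rwa [h0] at this
      exact h3.comp h2
    have h4 := (h1.mul_const (k (s + r) - k s)).const_add (k s)
    rw [zero_mul, add_zero] at h4
    refine h4.congr fun x => ?_
    have := hfe s (x - s)
    rw [add_sub_cancel] at this
    linarith
  refine ⟨hk, ?_⟩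
  -- Exchanging the roles of s and r in the equation shows that k (s + r) - k s is affine in k s
  -- with slope l.
  set l := k (r + r) - 1 - 1
  have hA : ∀ s, k (s + r) - k s = 1 + l * k s := by
    intro s
    have h1 := hfe r s
    rw [hkr, add_comm r s] at h1
    simp only [l]
    linarith
  have hfe' : ∀ s s', k (s + s') = k s + k s' + l * (k s * k s') := by
    intro s s'
    have h1 := hfe s s'
    rw [hA] at h1
    linarith
  by_cases hl : l = 0
  · refine ⟨0, k 1, ?_, fun s => ?_⟩
    all_goals
      have hlin : ∀ s, k s = s * k 1 := by
        intro s
        have := map_real_smul (AddMonoidHom.mk' k fun a b => by rw [hfe', hl]; ring) hk s 1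
        simpa using this
    · have := hlin r
      rw [hkr] at this
      exact pos_of_mul_pos_right (by rw [← this]; exact one_pos) hr.le
    · rw [hlin, boxCoxExp, if_pos rfl, mul_comm]
  -- For l = 0 the function k is additive; otherwise 1 + l * k is multiplicative, hence an
  -- exponential.
  · set A : ℝ → ℝ := fun s => 1 + l * k s
    have hAmul : ∀ s s', A (s + s') = A s * A s' := by
      intro s s'
      simp only [A, hfe']
      ring
    have hA0 : A 0 = 1 := by simp [A, h0]
    have hAne : ∀ s, A s ≠ 0 := by
      intro s hs
      have := hAmul s (-s)
      rw [add_neg_cancel, hA0, hs, zero_mul] at this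
      exact one_ne_zero this
    have hApos : ∀ s, 0 < A s := by
      intro s
      have h1 := hAmul (s / 2) (s / 2)
      rw [add_halves] at h1
      exact lt_of_le_of_ne (by rw [h1]; exact mul_self_nonneg _) (hAne s).symm
    have hAc : Continuous A := by fun_prop
    have hlog : ∀ s, Real.log (A s) = Real.log (A 1) * s := by
      intro s
      have := map_real_smul (AddMonoidHom.mk' (fun s => Real.log (A s))
        fun a b => by rw [hAmul, Real.log_mul (hAne a) (hAne b)]) (hAc.log hAne) s 1
      simpa [mul_comm] using this
    set ξ := Real.log (A 1)
    have hAexp : ∀ s, 1 + l * k s = Real.exp (ξ * s) := by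
      intro s
      rw [← hlog, Real.exp_log (hApos s)]
    have hlr : l = Real.exp (ξ * r) - 1 := by
      have := hAexp r
      rw [hkr] at this
      linarith
    have hξ : ξ ≠ 0 := by
      intro h
      rw [h, zero_mul, Real.exp_zero, sub_self] at hlr
      exact hl hlr
    refine ⟨ξ, ξ / l, ?_, fun s => ?_⟩
    · rw [hlr]
      rcases lt_or_gt_of_ne hξ with h | h
      · exact div_pos_of_neg_of_neg h
          (sub_neg.2 (Real.exp_lt_one_iff.2 (mul_neg_of_neg_of_pos h hr)))
      · exact div_pos h (sub_pos.2 (Real.one_lt_exp_iff.2 (mul_pos h hr)))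
    · rw [boxCoxExp, if_neg hξ, ← hAexp]
      field_simp
      ring

/-- A monotone function that solves the functional equation at its points of continuity is
continuous, and solves it everywhere. -/
lemma functionalEq_of_continuityPoints {h : ℝ → ℝ} {r : ℝ} (hr : 0 < r) (hmono : Monotone h)
    (h0 : h 0 = 0) (hhr : h r = 1) (hc0 : ContinuousAt h 0) (hcr : ContinuousAt h r)
    (hfe : ∀ s s', ContinuousAt h s → ContinuousAt h s' → ContinuousAt h (s + s') →
      ContinuousAt h (s + r) → h (s + s') - h s = h s' * (h (s + r) - h s)) :
    (∀ s, ContinuousAt h s) ∧ ∃ ξ c : ℝ, 0 < c ∧ ∀ s, h s = c * boxCoxExp ξ s := by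
  -- Right limits can be taken along continuity points, so k satisfies the equation everywhere; its
  -- continuity then forces h = k.
  set k := Function.rightLim h
  have hkmono : Monotone k := hmono.rightLim
  have hk_of_cont : ∀ {s}, ContinuousAt h s → k s = h s := fun hs =>
    hs.continuousWithinAt.rightLim_eq
  have hlim : ∀ s, Tendsto h (𝓝[>] s) (𝓝 (k s)) := hmono.tendsto_rightLim
  have hk0 : k 0 = 0 := (hk_of_cont hc0).trans h0
  have hkr : k r = 1 := (hk_of_cont hcr).trans hhr
  have hkc : ContinuousAt k 0 := by
    rw [ContinuousAt, hk0]
    have h2 : Tendsto (fun s => h (2 * s)) (𝓝 0) (𝓝 0) := by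
      have h3 : Tendsto (fun s : ℝ => 2 * s) (𝓝 0) (𝓝 0) := by
        have : Continuous fun s : ℝ => 2 * s := by fun_prop
        simpa using this.tendsto 0
      have h4 : Tendsto h (𝓝 0) (𝓝 0) := by
        have := hc0.tendsto
        rwa [h0] at this
      exact h4.comp h3
    have h5 : Tendsto h (𝓝 0) (𝓝 0) := by
      have := hc0.tendsto
      rwa [h0] at this
    refine tendsto_of_tendsto_of_tendsto_of_le_of_le h5
      (show Tendsto (fun s => max (h (2 * s)) (h (s / 2))) (𝓝 0) (𝓝 0) from ?_) ?_ ?_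
    · have h6 : Tendsto (fun s : ℝ => s / 2) (𝓝 0) (𝓝 0) := by
        have : Continuous fun s : ℝ => s / 2 := by fun_prop
        simpa using this.tendsto 0
      simpa using h2.max (h5.comp h6)
    · exact fun s => hmono.le_rightLim le_rfl
    · intro s
      rcases lt_trichotomy s 0 with hs | hs | hs
      · exact (hmono.rightLim_le (by linarith)).trans (le_max_right _ _)
      · simp only [hs, hk0, mul_zero, h0, zero_div, max_self, le_refl]
      · exact (hmono.rightLim_le (by linarith)).trans (le_max_left _ _)
  have hB := hmono.countable_not_continuousAt
  have hkfe : ∀ s s', k (s + s') - k s = k s' * (k (s + r) - k s) := by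
    intro s s'
    have t1 := (hlim (s + s')).comp (tendsto_add_mul_nhdsGT (s + s') two_pos)
    have t2 := (hlim s).comp (tendsto_add_mul_nhdsGT s one_pos)
    have t3 := (hlim s').comp (tendsto_add_mul_nhdsGT s' one_pos)
    have t4 := (hlim (s + r)).comp (tendsto_add_mul_nhdsGT (s + r) one_pos)
    have t5 := (t1.sub t2).sub (t3.mul (t4.sub t2))
    -- Shifting s and s' both by ε shifts their sum by 2 * ε; all but countably many ε make all four
    -- arguments continuity points of h.
    have hfreq := ((((hB.preimage_add_mul (s + s') two_ne_zero).union
      (hB.preimage_add_mul s one_ne_zero)).union (hB.preimage_add_mul s' one_ne_zero)).union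
        (hB.preimage_add_mul (s + r) one_ne_zero)).frequently_notMem_nhdsGT 0
    have := isClosed_singleton.mem_of_frequently_of_tendsto (s := {(0 : ℝ)})
      (hfreq.mono fun ε hε => ?_) t5
    · exact sub_eq_zero.1 this
    · simp only [Set.mem_union, Set.mem_preimage, Set.mem_ofPred_eq, not_or, not_not, one_mul]
        at hε
      obtain ⟨⟨⟨e1, e2⟩, e3⟩, e4⟩ := hε
      have e5 : s + ε + (s' + ε) = s + s' + 2 * ε := by ring
      have e6 : s + ε + r = s + r + ε := by ring
      have := hfe (s + ε) (s' + ε) e2 e3 (by rwa [e5]) (by rwa [e6])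
      rw [e5, e6] at this
      simp only [Function.comp_apply, one_mul, Set.mem_singleton_iff]
      linarith
  obtain ⟨hkcont, hsol⟩ := exists_eq_boxCoxExp hr hk0 hkr hkc hkfe
  have hhk : h = k := by
    funext s
    refine le_antisymm (hmono.le_rightLim le_rfl) ?_
    refine le_of_tendsto ((hkcont.tendsto s).mono_left (nhdsWithin_le_nhds (s := Set.Iio s))) ?_
    filter_upwards [self_mem_nhdsWithin] with x hx
    exact hmono.rightLim_le hx
  rw [hhk]
  exact ⟨fun s => hkcont.continuousAt, hsol⟩

/-- The analytic core of the extremal types theorem, in additive form. -/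
lemma exists_boxCoxExp_of_tendsto {u α β d : ℝ → ℝ} (hα : ∀ t, 0 < α t) (hd : Monotone d)
    (hne : ∃ s s', d s < d s')
    (hlim : ∀ s, ContinuousAt d s → Tendsto (fun t => (u (t + s) - β t) / α t) atTop (𝓝 (d s))) :
    ∃ (ξ : ℝ) (A : ℝ → ℝ), (∀ᶠ t in atTop, 0 < A t) ∧
      ∀ s, Tendsto (fun t => (u (t + s) - u t) / A t) atTop (𝓝 (boxCoxExp ξ s)) := by
  obtain ⟨s₁, s₂, hs⟩ := hne
  have hB := hd.countable_not_continuousAt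
  obtain ⟨p, hpc, -, hp⟩ := hB.exists_between_notMem (sub_one_lt s₁)
  obtain ⟨q, hqc, hq, -⟩ := hB.exists_between_notMem (lt_add_one s₂)
  simp only [Set.mem_ofPred_eq, not_not] at hpc hqc
  have hdpq : d p < d q := ((hd hp.le).trans_lt hs).trans_le (hd hq.le)
  have hpq : p < q := by
    by_contra h
    exact absurd (hd (not_lt.1 h)) (not_le.2 hdpq)
  set δ := d q - d p
  have hδ : 0 < δ := sub_pos.2 hdpq
  set r := q - p
  have hr : 0 < r := sub_pos.2 hpq
  -- Taking an increment of u itself as scale eliminates α and β, and normalises the limit h by h 0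
  -- = 0 and h r = 1.
  set A : ℝ → ℝ := fun t => u (t + r) - u t
  have hshift : Tendsto (fun t : ℝ => t - p) atTop atTop :=
    tendsto_atTop_add_const_right _ _ tendsto_id
  have hincr : ∀ s, ContinuousAt d (s + p) →
      Tendsto (fun t => (u (t + s) - u t) / α (t - p)) atTop (𝓝 (d (s + p) - d p)) := by
    intro s hsc
    refine (((hlim _ hsc).comp hshift).sub ((hlim p hpc).comp hshift)).congr fun t => ?_
    simp only [Function.comp_apply]
    rw [← sub_div, sub_sub_sub_cancel_right, sub_add_cancel, show t - p + (s + p) = t + s by ring]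
  have hA : Tendsto (fun t => A t / α (t - p)) atTop (𝓝 δ) := by
    have h1 := hincr r (by rwa [sub_add_cancel])
    rwa [sub_add_cancel] at h1
  have hApos : ∀ᶠ t in atTop, 0 < A t := by
    filter_upwards [hA.eventually_const_lt hδ] with t ht
    exact (div_pos_iff_of_pos_right (hα _)).1 ht
  set h : ℝ → ℝ := fun s => (d (s + p) - d p) / δ
  have hhc : ∀ {s}, ContinuousAt h s → ContinuousAt d (s + p) := by
    intro s hsc
    have h1 : ContinuousAt (fun x => h (x - p) * δ + d p) (s + p) := by
      refine ContinuousAt.add (ContinuousAt.mul ?_ continuousAt_const) continuousAt_const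
      refine ContinuousAt.comp (g := h) (f := fun x => x - p) (x := s + p) ?_ (by fun_prop)
      rwa [add_sub_cancel_right]
    refine h1.congr (Eventually.of_forall fun x => ?_)
    simp only [h, sub_add_cancel]
    field_simp
    ring
  have hch : ∀ {s}, ContinuousAt d (s + p) → ContinuousAt h s := by
    intro s hsc
    refine ContinuousAt.div_const (ContinuousAt.sub ?_ continuousAt_const) _
    exact ContinuousAt.comp (g := d) (f := fun x => x + p) (x := s) hsc (by fun_prop)
  have hconv : ∀ s, ContinuousAt h s →
      Tendsto (fun t => (u (t + s) - u t) / A t) atTop (𝓝 (h s)) := by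
    intro s hsc
    refine ((hincr s (hhc hsc)).div hA hδ.ne').congr' ?_
    filter_upwards [hApos] with t ht
    have := hα (t - p)
    simp only [Pi.div_apply]
    field_simp
  have hmono : Monotone h := fun x y hxy => by
    simp only [h]
    have := hd (show x + p ≤ y + p by linarith)
    gcongr
  have hadd : ∀ s, Tendsto (fun t : ℝ => t + s) atTop atTop := fun s =>
    tendsto_atTop_add_const_right _ _ tendsto_id
  obtain ⟨hcont, ξ, c, hc, hsol⟩ := functionalEq_of_continuityPoints hr hmono
    (by simp [h]) (by simp only [h, r, sub_add_cancel]; exact div_self hδ.ne')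
    (hch (by rwa [zero_add])) (hch (by rwa [sub_add_cancel])) (by
      intro s s' c1 c2 c3 c4
      have l1 := (hconv _ c3).sub (hconv _ c1)
      -- The functional equation arises by changing the base point from t to t + s, at the cost of
      -- the factor A (t + s) / A t.
      have l2 := ((hconv _ c2).comp (hadd s)).mul ((hconv _ c4).sub (hconv _ c1))
      refine tendsto_nhds_unique l1 (l2.congr' ?_)
      filter_upwards [hApos, (hadd s).eventually hApos] with t h1 h2
      have h3 : A (t + s) = u (t + (s + r)) - u (t + s) := by simp only [A, add_assoc]
      simp only [Function.comp_apply]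
      rw [← sub_div, ← sub_div, sub_sub_sub_cancel_right, sub_sub_sub_cancel_right, ← h3,
        add_assoc, div_mul_div_cancel₀ h2.ne'])
  refine ⟨ξ, fun t => c * A t, ?_, fun s => ?_⟩
  · filter_upwards [hApos] with t ht
    positivity
  · have h1 := (hconv s (hcont s)).div_const c
    rw [hsol, mul_div_cancel_left₀ _ hc.ne'] at h1
    refine h1.congr fun t => ?_
    simp only [div_div, mul_comm c]

/-! ### From convergence of F^n to convergence of quantiles -/

section ExtremalTypes

variable {μ ν : Measure ℝ} {a b : ℕ → ℝ}

/-- With n = ⌊t⌋, if tx(1 - F) > 1 at a_n z + b_n, then F^n ≤ e^(-n(1-F)) ≤ e^(-n/(tx)), which tends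
to e^(-1/x); this contradicts the strict inequality in the limit. -/
lemma eventually_tailQuantile_le {z x : ℝ} (hx : 0 < x)
    (hlim : Tendsto (fun n : ℕ => cdf μ (a n * z + b n) ^ n) atTop (𝓝 (cdf ν z)))
    (hz : Real.exp (-x⁻¹) < cdf ν z) :
    ∀ᶠ t : ℝ in atTop, tailQuantile (cdf μ) (t * x) ≤ a ⌊t⌋₊ * z + b ⌊t⌋₊ := by
  have h1 := hlim.comp (tendsto_nat_floor_atTop (α := ℝ))
  have h2 : Tendsto (fun t : ℝ => Real.exp (-((⌊t⌋₊ : ℝ) / t * x⁻¹))) atTop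
      (𝓝 (Real.exp (-x⁻¹))) := by
    have h3 := ((tendsto_nat_floor_div_atTop (R := ℝ)).mul_const x⁻¹).neg
    rw [one_mul] at h3
    exact (Real.continuous_exp.tendsto _).comp h3
  filter_upwards [h2.eventually_lt h1 hz, (tendsto_mul_atTop hx).eventually_gt_atTop 1,
    eventually_gt_atTop 0] with t h3 h4 h5
  rw [tailQuantile_le_iff h4]
  by_contra h6
  rw [not_le] at h6
  refine absurd h3 (not_lt.2 ?_)
  simp only [Function.comp_apply]
  set n := ⌊t⌋₊
  set p := cdf μ (a n * z + b n)
  calc p ^ n ≤ (Real.exp (-(1 - p))) ^ n := by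
        have h7 := cdf_nonneg μ (a n * z + b n)
        have h8 := Real.one_sub_le_exp_neg (1 - p)
        gcongr
        linarith
    _ = Real.exp (n * (-(1 - p))) := (Real.exp_nat_mul _ _).symm
    _ ≤ _ := by
        rw [Real.exp_le_exp, mul_neg, neg_le_neg_iff, div_mul_eq_mul_div, ← div_eq_mul_inv,
          div_div, mul_comm x t, div_le_iff₀ (by positivity)]
        have : (0 : ℝ) ≤ n := n.cast_nonneg
        nlinarith

/-- The opposite estimate: tx(1 - F) ≤ 1 gives F^n ≥ (1 - 1/(tx))^t because n = ⌊t⌋ ≤ t, and the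
right side tends to e^(-1/x). -/
lemma eventually_lt_tailQuantile {z x : ℝ} (hx : 0 < x)
    (hlim : Tendsto (fun n : ℕ => cdf μ (a n * z + b n) ^ n) atTop (𝓝 (cdf ν z)))
    (hz : cdf ν z < Real.exp (-x⁻¹)) :
    ∀ᶠ t : ℝ in atTop, a ⌊t⌋₊ * z + b ⌊t⌋₊ < tailQuantile (cdf μ) (t * x) := by
  have h1 := hlim.comp (tendsto_nat_floor_atTop (α := ℝ))
  have h2 := Real.tendsto_one_add_div_rpow_exp (-x⁻¹)
  filter_upwards [h1.eventually_lt h2 hz, (tendsto_mul_atTop hx).eventually_gt_atTop 1,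
    eventually_gt_atTop 0] with t h3 h4 h5
  rw [lt_tailQuantile_iff h4]
  by_contra h6
  rw [not_lt] at h6
  refine absurd h3 (not_lt.2 ?_)
  simp only [Function.comp_apply]
  set n := ⌊t⌋₊
  set p := cdf μ (a n * z + b n)
  have h7 : 1 + -x⁻¹ / t = 1 - 1 / (t * x) := by field_simp; ring
  have h8 : 1 / (t * x) < 1 := by rwa [div_lt_one (by linarith)]
  have h9 : 0 < 1 / (t * x) := by positivity
  rw [h7]
  calc (1 - 1 / (t * x)) ^ t ≤ (1 - 1 / (t * x)) ^ (n : ℝ) :=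
        Real.rpow_le_rpow_of_exponent_ge (by linarith) (by linarith) (Nat.floor_le h5.le)
    _ = (1 - 1 / (t * x)) ^ n := Real.rpow_natCast _ _
    _ ≤ p ^ n := by
        have : 1 - p ≤ 1 / (t * x) := by
          rw [le_div_iff₀ (by linarith)]
          linarith
        gcongr
        linarith

/-- The quantile function of `ν` on the scale on which the standard Gumbel distribution function
is the identity. -/
noncomputable def gumbelQuantile (ν : Measure ℝ) (s : ℝ) : ℝ :=
  tailQuantile (cdf ν) (1 / (1 - Real.exp (-Real.exp (-s))))

lemma gumbelQuantile_le_iff (s z : ℝ) :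
    gumbelQuantile ν s ≤ z ↔ Real.exp (-Real.exp (-s)) ≤ cdf ν z := by
  have h1 : Real.exp (-Real.exp (-s)) < 1 :=
    Real.exp_lt_one_iff.2 (neg_neg_of_pos (Real.exp_pos _))
  have h2 := Real.exp_pos (-Real.exp (-s))
  have h3 : 0 < 1 - Real.exp (-Real.exp (-s)) := by linarith
  rw [gumbelQuantile, tailQuantile_le_iff ((one_lt_div h3).2 (by linarith)), one_div_mul_eq_div,
    div_le_one h3, sub_le_sub_iff_left]

lemma monotone_gumbelQuantile : Monotone (gumbelQuantile ν) := by
  intro s t hst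
  rw [gumbelQuantile_le_iff]
  refine le_trans ?_ ((gumbelQuantile_le_iff t _).1 le_rfl)
  gcongr

/-- A constant quantile function c would force the distribution function to be 0 below c and 1 from
c on. -/
lemma exists_gumbelQuantile_lt [IsProbabilityMeasure ν] (hν : ∀ c : ℝ, ν ≠ Measure.dirac c) :
    ∃ s t, gumbelQuantile ν s < gumbelQuantile ν t := by
  by_contra! hcon
  have hconst : ∀ s, gumbelQuantile ν s = gumbelQuantile ν 0 := fun s =>
    le_antisymm (hcon 0 s) (hcon s 0)
  set c := gumbelQuantile ν 0
  have hiff : ∀ s z, c ≤ z ↔ Real.exp (-Real.exp (-s)) ≤ cdf ν z := by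
    intro s z
    rw [← gumbelQuantile_le_iff, hconst]
  refine hν c (Measure.ext_of_Iic _ _ fun z => ?_)
  rw [Measure.dirac_apply' _ measurableSet_Iic, ← ofReal_cdf]
  by_cases hz : c ≤ z
  · have h1 : Tendsto (fun s : ℝ => Real.exp (-Real.exp (-s))) atTop (𝓝 1) := by
      have := (Real.tendsto_exp_atBot.comp tendsto_neg_atTop_atBot).neg
      rw [neg_zero] at this
      have h2 := (Real.continuous_exp.tendsto 0).comp this
      rwa [Real.exp_zero] at h2
    have h2 : 1 ≤ cdf ν z := le_of_tendsto h1 (Eventually.of_forall fun s => (hiff s z).1 hz)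
    rw [le_antisymm (cdf_le_one ν z) h2, Set.indicator_of_mem (show c ∈ Set.Iic z from hz)]
    simp
  · have h1 : Tendsto (fun s : ℝ => Real.exp (-Real.exp (-s))) atBot (𝓝 0) :=
      Real.tendsto_exp_atBot.comp (tendsto_neg_atTop_atBot.comp
        (Real.tendsto_exp_atTop.comp tendsto_neg_atBot_atTop))
    have h2 : cdf ν z ≤ 0 := ge_of_tendsto h1 (Eventually.of_forall fun s =>
      (not_le.1 (mt (hiff s z).2 hz)).le)
    rw [le_antisymm h2 (cdf_nonneg ν z), Set.indicator_of_notMem (show c ∉ Set.Iic z from hz)]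
    simp

lemma tendsto_tailQuantile_of_continuousAt (ha : ∀ n, 0 < a n)
    (hlim : ∀ z : ℝ, ContinuousAt (cdf ν) z →
      Tendsto (fun n : ℕ => cdf μ (a n * z + b n) ^ n) atTop (𝓝 (cdf ν z)))
    {s : ℝ} (hs : ContinuousAt (gumbelQuantile ν) s) :
    Tendsto (fun t : ℝ => (tailQuantile (cdf μ) (t * Real.exp s) - b ⌊t⌋₊) / a ⌊t⌋₊) atTop
      (𝓝 (gumbelQuantile ν s)) := by
  have hB := (monotone_cdf ν).countable_not_continuousAt
  have hexp : (Real.exp s)⁻¹ = Real.exp (-s) := (Real.exp_neg s).symm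
  refine tendsto_order.2 ⟨fun v hv => ?_, fun v hv => ?_⟩
  · obtain ⟨z, hzc, hvz, hz⟩ := hB.exists_between_notMem hv
    simp only [Set.mem_ofPred_eq, not_not] at hzc
    have h1 := mt (gumbelQuantile_le_iff s z).2 (not_le.2 hz)
    rw [not_le, ← hexp] at h1
    filter_upwards [eventually_lt_tailQuantile (Real.exp_pos s) (hlim z hzc) h1] with t ht
    refine hvz.trans ?_
    rw [lt_div_iff₀ (ha _)]
    linarith
  -- The Galois connection gives only a weak inequality at s; passing to some s' > s, which
  -- continuity at s permits, makes it strict.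
  · have h0 : ∀ᶠ s' in 𝓝[>] s, gumbelQuantile ν s' < v :=
      (hs.tendsto.mono_left nhdsWithin_le_nhds).eventually_lt_const hv
    obtain ⟨s', hs', hss'⟩ := (h0.and self_mem_nhdsWithin).exists
    obtain ⟨z, hzc, hz, hzv⟩ := hB.exists_between_notMem hs'
    simp only [Set.mem_ofPred_eq, not_not] at hzc
    have h1 := (gumbelQuantile_le_iff s' z).1 hz.le
    have h2 : Real.exp (-(Real.exp s)⁻¹) < cdf ν z := by
      refine lt_of_lt_of_le ?_ h1
      rw [hexp]
      have : s < s' := hss'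
      gcongr
    filter_upwards [eventually_tailQuantile_le (Real.exp_pos s) (hlim z hzc) h2] with t ht
    refine lt_of_le_of_lt ?_ hzv
    rw [div_le_iff₀ (ha _)]
    linarith

/-- The extremal types theorem: a distribution function in some maximum domain of attraction
satisfies the extended regular variation condition. -/
theorem exists_isAuxiliary (h : InSomeMDA (cdf μ)) :
    ∃ (ξ : ℝ) (a : ℝ → ℝ), IsAuxiliary (cdf μ) ξ a := by
  obtain ⟨a, b, ν, ha, hν, hne, hlim⟩ := h
  obtain ⟨ξ, A, hA, hconv⟩ := exists_boxCoxExp_of_tendsto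
    (u := fun t => tailQuantile (cdf μ) (Real.exp t)) (α := fun t => a ⌊Real.exp t⌋₊)
    (β := fun t => b ⌊Real.exp t⌋₊) (fun t => ha _) monotone_gumbelQuantile
    (exists_gumbelQuantile_lt hne) (fun s hs => by
      refine ((tendsto_tailQuantile_of_continuousAt ha hlim hs).comp
        Real.tendsto_exp_atTop).congr fun t => ?_
      simp only [Function.comp_apply, Real.exp_add])
  -- `IsAuxiliary` asks for positivity at every t ≥ 1, whereas A is only eventually positive; the
  -- value 1 is a filler.
  refine ⟨ξ, fun t => if 0 < A (Real.log t) then A (Real.log t) else 1, fun t _ => ?_,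
    fun x hx => ?_⟩
  · dsimp only
    split_ifs with h
    exacts [h, one_pos]
  · have h1 := (hconv (Real.log x)).comp Real.tendsto_log_atTop
    rw [boxCoxExp_log ξ hx] at h1
    refine h1.congr' ?_
    filter_upwards [Real.tendsto_log_atTop.eventually hA, eventually_gt_atTop 0] with t h2 h3
    simp only [Function.comp_apply]
    rw [if_pos h2, Real.exp_add, Real.exp_log h3, Real.exp_log hx]

end ExtremalTypes

/-! ### Expected improvement -/

section Expectation

variable {Ω : Type*} [MeasurableSpace Ω] {P : Measure Ω} {X : ℕ → Ω → ℝ}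

lemma integral_improvementRate (n : ℕ) (x : ℝ) :
    ∫ ω, improvementRate X n x ω ∂P = (∫ ω, max (best X n ω - x) 0 ∂P) / |x| :=
  integral_div _ _

lemma integral_relativeGap (s : ℝ) (n : ℕ) (x : ℝ) :
    ∫ ω, relativeGap X s n x ω ∂P = (∫ ω, (s - max (best X n ω) x) ∂P) / |s| :=
  integral_div _ _

variable [IsProbabilityMeasure P]

/-- Asymptotics of the expected excess for an infinite right endpoint. -/
lemma tendsto_integral_excess_div (hmeas : ∀ i, Measurable (X i)) (hindep : iIndepFun X P)
    (hident : ∀ i, IdentDistrib (X i) (X 0) P P) {ρ : ℝ} (hρ : ρ < 1)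
    (hU : RegularlyVarying ρ (tailQuantile (cdf (P.map (X 0)))))
    (htop : Tendsto (tailQuantile (cdf (P.map (X 0)))) atTop atTop) (x : ℝ) :
    Tendsto (fun n : ℕ => (∫ ω, max (best X n ω - x) 0 ∂P) / tailQuantile (cdf (P.map (X 0))) n)
      atTop (𝓝 (Real.Gamma (1 - ρ))) := by
  set U := tailQuantile (cdf (P.map (X 0)))
  set k : ℝ → ℝ := fun t => max (U t - x) 0
  have hkU : Tendsto (fun t => k t / U t) atTop (𝓝 1) := by
    have h1 := (htop.inv_tendsto_atTop.const_mul x).const_sub 1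
    rw [mul_zero, sub_zero] at h1
    refine h1.congr' ?_
    filter_upwards [htop.eventually_gt_atTop 0, htop.eventually_ge_atTop x] with t h2 h3
    simp only [k, Pi.inv_apply]
    rw [max_eq_left (by linarith), sub_div, div_self h2.ne', div_eq_mul_inv]
  have hk : RegularlyVarying ρ k := hU.of_div_tendsto one_pos hkU
  have hmono : MonotoneOn k (Set.Ioi 1) := fun s hs t ht hst =>
    max_le_max_right 0 (sub_le_sub_right (monotoneOn_tailQuantile _ hs ht hst) x)
  have h1 := (hk.tendsto_integral_of_monotoneOn hρ hmono fun t => le_max_right _ _).mul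
    (hkU.comp tendsto_natCast_atTop_atTop)
  rw [mul_one] at h1
  refine h1.congr' ?_
  filter_upwards [tendsto_natCast_atTop_atTop.eventually hk.1, eventually_ne_atTop 0] with n h2 h3
  rw [integral_comp_best hmeas hindep hident h3
    (h := fun z => max (z - x) 0) (by fun_prop)]
  exact div_mul_div_cancel₀ h2.ne'

/-- Asymptotics of the expected gap for a finite right endpoint. -/
lemma tendsto_integral_gap_div (hmeas : ∀ i, Measurable (X i)) (hindep : iIndepFun X P)
    (hident : ∀ i, IdentDistrib (X i) (X 0) P P) {ρ s : ℝ} (hρ : ρ < 1)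
    (hs : rightEndpoint (cdf (P.map (X 0))) = (s : EReal))
    (hU : RegularlyVarying ρ fun t => s - tailQuantile (cdf (P.map (X 0))) t) {x : ℝ}
    (hx : x < s) :
    Tendsto (fun n : ℕ => (∫ ω, (s - max (best X n ω) x) ∂P) /
      (s - tailQuantile (cdf (P.map (X 0))) n)) atTop (𝓝 (Real.Gamma (1 - ρ))) := by
  set U := tailQuantile (cdf (P.map (X 0)))
  -- Truncation at x bounds the gap by s - x on all of (1, ∞), as the lower Potter bound requires,
  -- and changes nothing for large t.
  set k : ℝ → ℝ := fun t => s - max (U t) x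
  have hlim : Tendsto U atTop (𝓝 s) := tendsto_tailQuantile_rightEndpoint hs
  have hkU : (fun t => s - U t) =ᶠ[atTop] k := by
    filter_upwards [hlim.eventually_const_lt hx] with t ht
    simp only [k, max_eq_left ht.le]
  have hk : RegularlyVarying ρ k := hU.congr' hkU
  have hanti : AntitoneOn k (Set.Ioi 1) := fun t ht t' ht' h =>
    sub_le_sub_left (max_le_max_right x (monotoneOn_tailQuantile _ ht ht' h)) s
  have h1 := hk.tendsto_integral_of_antitoneOn hρ hanti
    (fun t ht => sub_nonneg.2 (max_le (tailQuantile_le_rightEndpoint hs ht) hx.le))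
    (M := s - x) (fun t _ => sub_le_sub_left (le_max_right _ _) s)
  refine h1.congr' ?_
  filter_upwards [tendsto_natCast_atTop_atTop.eventually hkU, eventually_ne_atTop 0] with n h2 h3
  rw [integral_comp_best hmeas hindep hident h3 (h := fun z => s - max z x) (by fun_prop), h2]

/-- Pointwise s - max(Z, x) = (s - x) - (Z - x)_+, so the two finite-endpoint statements concern the
same expectation; Z ≤ s almost surely gives integrability. -/
lemma integral_gap_eq (hmeas : ∀ i, Measurable (X i)) (hindep : iIndepFun X P)
    (hident : ∀ i, IdentDistrib (X i) (X 0) P P) {s : ℝ}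
    (hs : rightEndpoint (cdf (P.map (X 0))) = (s : EReal)) {x : ℝ} (hx : x < s) {n : ℕ}
    (hn : n ≠ 0) :
    ∫ ω, (s - max (best X n ω) x) ∂P = (s - x) - ∫ ω, max (best X n ω - x) 0 ∂P := by
  have hint : Integrable (fun ω => max (best X n ω - x) 0) P := by
    refine Integrable.of_mem_Icc 0 (s - x) ?_ ?_
    · exact (((measurable_best hmeas n).sub_const x).max measurable_const).aemeasurable
    · filter_upwards [ae_best_le hmeas hindep hident hn (cdf_rightEndpoint hs)] with ω hω
      exact ⟨le_max_right _ _, max_le (by linarith) (by linarith)⟩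
  have h1 := integral_sub (integrable_const (μ := P) (s - x)) hint
  rw [integral_const, probReal_univ, one_smul] at h1
  rw [← h1]
  refine integral_congr_ae (Eventually.of_forall fun ω => ?_)
  simp only
  rw [← sub_self x, max_sub_sub_right]
  ring

/-- Both limit statements for a finite right endpoint, normalised by any function `g` that is
asymptotically proportional to the gap `s - U`. -/
lemma tendsto_gap_statements (hmeas : ∀ i, Measurable (X i)) (hindep : iIndepFun X P)
    (hident : ∀ i, IdentDistrib (X i) (X 0) P P) {ρ s c : ℝ} {g : ℝ → ℝ} (hρ : ρ < 1)
    (hs : rightEndpoint (cdf (P.map (X 0))) = (s : EReal))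
    (hU : RegularlyVarying ρ fun t => s - tailQuantile (cdf (P.map (X 0))) t)
    (hg : Tendsto (fun t => (s - tailQuantile (cdf (P.map (X 0))) t) / g t) atTop (𝓝 c))
    {x : ℝ} (hx : x < s) :
    Tendsto (fun n : ℕ => (1 / g n) *
        ((s - x) / |x| - ∫ ω, improvementRate X n x ω ∂P)) atTop
      (𝓝 (Real.Gamma (1 - ρ) * c / |x|)) ∧
    Tendsto (fun n : ℕ => (1 / g n) * ∫ ω, relativeGap X s n x ω ∂P) atTop
      (𝓝 (Real.Gamma (1 - ρ) * c / |s|)) := by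
  have h1 := (tendsto_integral_gap_div hmeas hindep hident hρ hs hU hx).mul
    (hg.comp tendsto_natCast_atTop_atTop)
  have hpos := (tendsto_natCast_atTop_atTop (R := ℝ)).eventually hU.1
  constructor
  · refine (h1.div_const |x|).congr' ?_
    filter_upwards [hpos, eventually_ne_atTop 0] with n h2 h3
    rw [integral_improvementRate, ← sub_div, ← integral_gap_eq hmeas hindep hident hs hx h3,
      Function.comp_apply, div_mul_div_cancel₀ h2.ne']
    ring
  · refine (h1.div_const |s|).congr' ?_
    filter_upwards [hpos] with n h2
    rw [integral_relativeGap, Function.comp_apply, div_mul_div_cancel₀ h2.ne']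
    ring

end Expectation

lemma Gamma_one_sub {ξ : ℝ} (hξ : ξ ≠ 0) : Real.Gamma (1 - ξ) = -ξ * Real.Gamma (-ξ) := by
  rw [← Real.Gamma_add_one (neg_ne_zero.2 hξ), neg_add_eq_sub]

end RMS

/-! ### Assembly of the four cases -/

theorem corollary1 {Ω : Type*} [MeasurableSpace Ω] (P : Measure Ω) [IsProbabilityMeasure P]
    (X : ℕ → Ω → ℝ) (hmeas : ∀ i, Measurable (X i)) (hindep : iIndepFun X P)
    (hident : ∀ i, IdentDistrib (X i) (X 0) P P)
    (F : ℝ → ℝ) (hF : ∀ x, F x = P.real {ω | X 0 ω ≤ x})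
    (hx0 : RMS.rightEndpoint F ≠ 0)
    (hGEV : RMS.InSomeMDA F)
    (hint : Integrable (X 0) P) :
    (∃ (ξ : ℝ) (a : ℝ → ℝ), RMS.IsAuxiliary F ξ a) ∧
    ∀ (ξ : ℝ) (a : ℝ → ℝ), RMS.IsAuxiliary F ξ a → ξ < 1 →
      -- case 1
      (0 < ξ →
        RMS.rightEndpoint F = ⊤ ∧
        RMS.RegularlyVarying ξ a ∧
        ∀ x : ℝ, x ≠ 0 →
          Tendsto (fun n : ℕ => (1 / a n) * ∫ ω, RMS.improvementRate X n x ω ∂P) atTop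
            (𝓝 (-(Real.Gamma (-ξ) / |x|))) ∧
          0 < -(Real.Gamma (-ξ) / |x|)) ∧
      -- case 2
      (ξ = 0 → RMS.rightEndpoint F = ⊤ →
        RMS.RegularlyVarying 0 (RMS.tailQuantile F) ∧
        ∀ x : ℝ, x ≠ 0 →
          Tendsto (fun n : ℕ => (1 / RMS.tailQuantile F n) *
              ∫ ω, RMS.improvementRate X n x ω ∂P) atTop
            (𝓝 (1 / |x|))) ∧
      -- case 3
      (ξ = 0 → ∀ s : ℝ, RMS.rightEndpoint F = (s : EReal) →
        RMS.RegularlyVarying 0 (fun t => s - RMS.tailQuantile F t) ∧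
        (∀ x : ℝ, x ≠ 0 → x < s →
          Tendsto (fun n : ℕ => (1 / (s - RMS.tailQuantile F n)) *
              ((s - x) / |x| - ∫ ω, RMS.improvementRate X n x ω ∂P)) atTop
            (𝓝 (1 / |x|))) ∧
        (∀ x : ℝ, x < s →
          Tendsto (fun n : ℕ => (1 / (s - RMS.tailQuantile F n)) *
              ∫ ω, RMS.relativeGap X s n x ω ∂P) atTop
            (𝓝 (1 / |s|)))) ∧
      -- case 4
      (ξ < 0 → ∃ s : ℝ, RMS.rightEndpoint F = (s : EReal) ∧
        RMS.RegularlyVarying ξ a ∧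
        (∀ x : ℝ, x ≠ 0 → x < s →
          Tendsto (fun n : ℕ => (1 / a n) *
              ((s - x) / |x| - ∫ ω, RMS.improvementRate X n x ω ∂P)) atTop
            (𝓝 (Real.Gamma (-ξ) / |x|)) ∧
          0 < Real.Gamma (-ξ) / |x|) ∧
        (∀ x : ℝ, x < s →
          Tendsto (fun n : ℕ => (1 / a n) * ∫ ω, RMS.relativeGap X s n x ω ∂P) atTop
            (𝓝 (Real.Gamma (-ξ) / |s|)) ∧
          0 < Real.Gamma (-ξ) / |s|)) := by
  have hFμ : F = cdf (P.map (X 0)) := by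
    have : IsProbabilityMeasure (P.map (X 0)) :=
      Measure.isProbabilityMeasure_map (hmeas 0).aemeasurable
    funext x
    rw [hF, cdf_eq_real, map_measureReal_apply (hmeas 0) measurableSet_Iic]
    rfl
  subst hFμ
  have hmono := RMS.monotoneOn_tailQuantile (P.map (X 0))
  refine ⟨RMS.exists_isAuxiliary hGEV, fun ξ a ha hξ1 => ⟨fun hξ => ?_, fun hξ htop => ?_,
    fun hξ s hs => ?_, fun hξ => ?_⟩⟩
  · have htop := ha.tendsto_atTop_of_pos hmono hξ
    have hdiv := ha.tendsto_div_of_pos hmono hξ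
    have hU := ha.regularlyVarying.of_div_tendsto (one_div_pos.2 hξ) hdiv
    refine ⟨RMS.tendsto_tailQuantile_atTop_iff.1 htop, ha.regularlyVarying, fun x hx => ?_⟩
    have hval : Real.Gamma (1 - ξ) * (1 / ξ) / |x| = -(Real.Gamma (-ξ) / |x|) := by
      rw [RMS.Gamma_one_sub hξ.ne']
      field_simp
    rw [← hval]
    refine ⟨?_, ?_⟩
    · have h1 := ((RMS.tendsto_integral_excess_div hmeas hindep hident hξ1 hU htop x).mul
        (hdiv.comp tendsto_natCast_atTop_atTop)).div_const |x|
      refine h1.congr' ?_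
      filter_upwards [tendsto_natCast_atTop_atTop.eventually hU.1] with n hn
      rw [RMS.integral_improvementRate, Function.comp_apply, div_mul_div_cancel₀ hn.ne']
      ring
    · have := Real.Gamma_pos_of_pos (sub_pos.2 hξ1)
      positivity
  · subst hξ
    have htop' := RMS.tendsto_tailQuantile_atTop_iff.2 htop
    have hU := RMS.regularlyVarying_zero_of_div_tendsto_atTop ha.eventually_pos
      (ha.tendsto_div_atTop_of_zero htop') ha.2
    refine ⟨hU, fun x _ => ?_⟩
    have h1 := (RMS.tendsto_integral_excess_div hmeas hindep hident zero_lt_one hU htop'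
      x).div_const |x|
    rw [sub_zero, Real.Gamma_one] at h1
    refine h1.congr fun n => ?_
    rw [RMS.integral_improvementRate]
    ring
  · subst hξ
    have hU : RMS.RegularlyVarying 0
        fun t => s - RMS.tailQuantile (cdf (P.map (X 0))) t := by
      refine RMS.regularlyVarying_zero_of_div_tendsto_atTop (l := fun x => -RMS.boxCox 0 x)
        ha.eventually_pos (ha.tendsto_gap_div_atTop_of_zero ?_) fun x hx => ?_
      · filter_upwards [eventually_gt_atTop 1] with t ht
        exact RMS.tailQuantile_le_rightEndpoint hs ht
      · refine (ha.2 x hx).neg.congr fun t => ?_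
        ring
    have hg : Tendsto (fun t => (s - RMS.tailQuantile (cdf (P.map (X 0))) t) /
        (s - RMS.tailQuantile (cdf (P.map (X 0))) t)) atTop (𝓝 1) := by
      refine tendsto_const_nhds.congr' ?_
      filter_upwards [hU.1] with t ht
      exact (div_self ht.ne').symm
    have key := fun {x : ℝ} (hx : x < s) =>
      RMS.tendsto_gap_statements hmeas hindep hident zero_lt_one hs hU hg hx
    simp only [sub_zero, Real.Gamma_one, one_mul] at key
    exact ⟨hU, fun x _ hx => (key hx).1, fun x hx => (key hx).2⟩
  · obtain ⟨B, hB⟩ := ha.exists_bound_of_neg hξ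
    obtain ⟨s, hs⟩ := RMS.exists_rightEndpoint_eq_coe hB
    have hdiv := ha.tendsto_div_of_neg hξ (RMS.tendsto_tailQuantile_rightEndpoint hs)
    have hU := ha.regularlyVarying.of_div_tendsto (div_pos_of_neg_of_neg (by norm_num) hξ) hdiv
    -- Needed for the strict positivity of Γ(-ξ)/|s|.
    have hs0 : s ≠ 0 := by
      rintro rfl
      exact hx0 (by rw [hs, EReal.coe_zero])
    have hΓ : Real.Gamma (1 - ξ) * (-1 / ξ) = Real.Gamma (-ξ) := by
      rw [RMS.Gamma_one_sub hξ.ne]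
      have := hξ.ne
      field_simp
    have hΓpos : 0 < Real.Gamma (-ξ) := Real.Gamma_pos_of_pos (neg_pos.2 hξ)
    have key := fun {x : ℝ} (hx : x < s) =>
      RMS.tendsto_gap_statements hmeas hindep hident hξ1 hs hU hdiv hx
    rw [hΓ] at key
    exact ⟨s, hs, ha.regularlyVarying,
      fun x hx hxs => ⟨(key hxs).1, div_pos hΓpos (abs_pos.2 hx)⟩,
      fun x hxs => ⟨(key hxs).2, div_pos hΓpos (abs_pos.2 hs0)⟩⟩
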